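/- Let $d\ge 1$, let $\mathbb B_k$ be the open unit ball of $\mathbb C^k$, and let $H^2_d$ be the Drury–Arveson space: the completion of $\mathbb C[z_1,\dots,z_d]$ for $\langle z^\alpha,z^\beta\rangle=\delta_{\alpha\beta}\,\alpha!/|\alpha|!$, a Hilbert space of holomorphic functions on $\mathbb B_d$ on which multiplication by $z_j$ is a bounded operator $M_{z_j}$. For $(\lambda,\mu)\in\mathbb B_d$ with $\lambda\in\mathbb C^{d-1}$, $\mu\in\mathbb C$, and $\ell\ge 0$, let $k^{(\ell)}_{(\lambda,\mu)}\in H^2_d$ be the vector with $\langle f,k^{(\ell)}_{(\lambda,\mu)}\rangle=\frac{\partial^\ell f}{\partial z_d^\ell}(\lambda,\mu)$ for all $f\in H^2_d$. For a domain $\Omega\subset\mathbb C^{m}$, a commuting tuple $T=(T_1,\dots,T_m)$ of bounded operators on a Hilbert space $\mathcal H$ is in the Cowen–Douglas class $B_n(\Omega)$ if for every $\omega\in\Omega$ the operator $\mathcal H\to\mathcal H\otimes\mathbb C^m$, $h\mapsto((T_j-\omega_j)h)_j$, has closed range, its kernel $\bigcap_j\ker(T_j-\omega_j)$ has dimension $n$,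 and these kernels for $\omega\in\Omega$ together span a dense subspace of $\mathcal H$. Let $p\in\mathbb C[z_1,\dots,z_d]$ be homogeneous of degree $n$ with $p(0,\dots,0,1)\neq 0$. Let $\mathcal H_p=H^2_d\ominus pH^2_d$ and $S_j=P_{\mathcal H_p}M_{z_j}|_{\mathcal H_p}$. Call $U\subset\mathbb B_{d-1}$ admissible if $U$ is open, connected, contains $0$, is invariant under entrywise complex conjugation, and for every $\lambda\in U$ the polynomial $p(\lambda,\cdot)$ has precisely $n$ roots $\mu$, counted with multiplicity, with $(\lambda,\mu)\in\mathbb B_d$. Then some ball centred at the origin of $\mathbb C^{d-1}$ is admissible. For every admissible $U$, the tuple $(S_1^*,\dots,S_{d-1}^*)$ is in $B_n(U)$, and for every $\lambda\in U$ $$\bigcap_{j=1}^{d-1}\ker\big(S_j^*-\overline{\lambda_j}\big)=\operatorname{span}\big\{k^{(\ell)}_{(\lambda,\mu)} : p(\lambda,\mu)=0,\ 0\le \ell<\operatorname{mult}_\mu p(\lambda,\cdot)\big\}.$$ -/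

import Mathlib

open scoped Nat ComplexConjugate

noncomputable section

namespace DruryArveson

/-- `‖z^α‖² = α! / |α|!`, the squared norm of a monomial in the Drury-Arveson space. -/
def weight {d : ℕ} (α : Fin d →₀ ℕ) : ℝ := ((∏ i, (α i)! : ℕ) : ℝ) / ((∑ i, α i)! : ℕ)

theorem weight_pos {d : ℕ} (α : Fin d →₀ ℕ) : 0 < weight α := by
  unfold weight
  have h : 0 < ∏ i, (α i)! := Finset.prod_pos fun i _ => Nat.factorial_pos _
  have h' : 0 < (∑ i, α i)! := Nat.factorial_pos _
  positivity

/-- The Drury-Arveson space `H²_d`: the completion of `ℂ[z_1, …, z_d]` for the inner product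
`⟨z^α, z^β⟩ = δ_{αβ} α! / |α|!`, realized as the space of square summable coordinates `f α` with
respect to the orthonormal basis `z^α / ‖z^α‖`. -/
abbrev H2 (d : ℕ) : Type := lp (fun _ : Fin d →₀ ℕ => ℂ) 2

/-- The power series `∑ c_α z^α` of an element of `H²_d`. The coordinate of `f` along
`z^α / ‖z^α‖` is `f α`, so `c_α = f α / ‖z^α‖`. -/
def toSeries {d : ℕ} : H2 d →ₗ[ℂ] MvPowerSeries (Fin d) ℂ where
  toFun f := fun α => f α / (Real.sqrt (weight α) : ℂ)
  map_add' f g := by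
    funext α
    change (f α + g α) / _ = f α / _ + g α / _
    ring
  map_smul' c f := by
    funext α
    change (c * f α) / _ = c * (f α / _)
    ring

/-- The Taylor coefficient of `z^α` in `f`. -/
def coeff {d : ℕ} (f : H2 d) (α : Fin d →₀ ℕ) : ℂ := MvPowerSeries.coeff α (toSeries f)

theorem coeff_def {d : ℕ} (f : H2 d) (α : Fin d →₀ ℕ) :
    coeff f α = f α / (Real.sqrt (weight α) : ℂ) := rfl

theorem coe_eq {d : ℕ} (f : H2 d) (α : Fin d →₀ ℕ) :
    f α = (Real.sqrt (weight α) : ℂ) * coeff f α := by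
  have h : (Real.sqrt (weight α) : ℂ) ≠ 0 := by
    exact_mod_cast (Real.sqrt_pos.2 (weight_pos α)).ne'
  rw [coeff_def]
  field_simp

/-- The inner product of `H²_d` in terms of Taylor coefficients. -/
theorem inner_eq {d : ℕ} (f g : H2 d) :
    inner ℂ f g = ∑' α, (weight α : ℂ) * (conj (coeff f α) * coeff g α) := by
  rw [lp.inner_eq_tsum]
  refine tsum_congr fun α => ?_
  have h : (Real.sqrt (weight α) : ℂ) * (Real.sqrt (weight α) : ℂ) = (weight α : ℂ) := by
    exact_mod_cast Real.mul_self_sqrt (weight_pos α).le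
  rw [RCLike.inner_apply, coe_eq f α, coe_eq g α, map_mul, Complex.conj_ofReal, ← h]
  ring

/-- The value at `z` of the holomorphic function on the unit ball defined by `f`
(the series converges absolutely for `‖z‖ < 1`). -/
def eval {d : ℕ} (f : H2 d) (z : EuclideanSpace ℂ (Fin d)) : ℂ :=
  ∑' α : Fin d →₀ ℕ, coeff f α * ∏ i, z i ^ α i

/-- Coordinates of `z_j f`. -/
def shiftFun {d : ℕ} (j : Fin d) (f : H2 d) (β : Fin d →₀ ℕ) : ℂ :=
  if β j = 0 then 0 else (Real.sqrt (weight β) : ℂ) * coeff f (β - Finsupp.single j 1)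

theorem weight_add_single_le {d : ℕ} (j : Fin d) (α : Fin d →₀ ℕ) :
    weight (α + Finsupp.single j 1) ≤ weight α := by
  have h1 : ∑ i, (α + Finsupp.single j 1 : Fin d →₀ ℕ) i = (∑ i, α i) + 1 := by
    simp [Finset.sum_add_distrib, Finsupp.single_apply]
  have h2 : ∏ i, ((α + Finsupp.single j 1 : Fin d →₀ ℕ) i)! = (α j + 1) * ∏ i, (α i)! := by
    rw [← Finset.mul_prod_erase _ _ (Finset.mem_univ j),
      ← Finset.mul_prod_erase (f := fun i => (α i)!) _ (Finset.mem_univ j), ← mul_assoc]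
    congr 1
    · simp [Nat.factorial_succ]
    · refine Finset.prod_congr rfl fun i hi => ?_
      have : j ≠ i := (Finset.ne_of_mem_erase hi).symm
      simp [this]
  have h3 : α j ≤ ∑ i, α i := Finset.single_le_sum (fun _ _ => Nat.zero_le _) (Finset.mem_univ j)
  unfold weight
  rw [h1, h2, Nat.factorial_succ]
  have h4 : (0 : ℝ) < ((∑ i, α i)! : ℕ) := by exact_mod_cast Nat.factorial_pos _
  have h5 : ((α j : ℕ) : ℝ) ≤ ((∑ i, α i : ℕ) : ℝ) := by exact_mod_cast h3
  have h6 : (0 : ℝ) ≤ ((∏ i, (α i)! : ℕ) : ℝ) := Nat.cast_nonneg _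
  rw [Nat.cast_mul, Nat.cast_mul, Nat.cast_add, Nat.cast_one,
    Nat.cast_add (∑ i, α i) 1, Nat.cast_one, div_le_div_iff₀ (by positivity) h4]
  have h7 : (0 : ℝ) ≤ ((∏ i, (α i)! : ℕ) : ℝ) * ((∑ i, α i)! : ℕ) := by positivity
  nlinarith [mul_le_mul_of_nonneg_right h5 h7]

theorem shiftFun_add_single {d : ℕ} (j : Fin d) (f : H2 d) (α : Fin d →₀ ℕ) :
    shiftFun j f (α + Finsupp.single j 1)
      = (Real.sqrt (weight (α + Finsupp.single j 1)) : ℂ) * coeff f α := by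
  simp [shiftFun]

theorem shiftFun_of_notMem_range {d : ℕ} (j : Fin d) (f : H2 d) (β : Fin d →₀ ℕ)
    (hβ : β ∉ Set.range fun α : Fin d →₀ ℕ => α + Finsupp.single j 1) : shiftFun j f β = 0 := by
  by_contra h
  have hj : β j ≠ 0 := fun h0 => h (by simp [shiftFun, h0])
  refine hβ ⟨β - Finsupp.single j 1, ?_⟩
  refine tsub_add_cancel_of_le (Finsupp.single_le_iff.2 (Nat.one_le_iff_ne_zero.2 hj))

theorem norm_shiftFun_add_single_le {d : ℕ} (j : Fin d) (f : H2 d) (α : Fin d →₀ ℕ) :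
    ‖shiftFun j f (α + Finsupp.single j 1)‖ ≤ ‖f α‖ := by
  rw [shiftFun_add_single, coe_eq f α, norm_mul, norm_mul, Complex.norm_real, Complex.norm_real,
    Real.norm_of_nonneg (Real.sqrt_nonneg _), Real.norm_of_nonneg (Real.sqrt_nonneg _)]
  exact mul_le_mul_of_nonneg_right (Real.sqrt_le_sqrt (weight_add_single_le j α)) (norm_nonneg _)

theorem injective_add_single {d : ℕ} (j : Fin d) :
    Function.Injective fun α : Fin d →₀ ℕ => α + Finsupp.single j 1 :=
  add_left_injective _

theorem summable_sq {d : ℕ} (f : H2 d) : Summable fun α => ‖f α‖ ^ (2 : ℝ) := by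
  simpa using (lp.memℓp f).summable (by norm_num)

theorem summable_shiftFun {d : ℕ} (j : Fin d) (f : H2 d) :
    Summable fun β => ‖shiftFun j f β‖ ^ (2 : ℝ) := by
  rw [← (injective_add_single j).summable_iff]
  · refine (summable_sq f).of_nonneg_of_le (fun α => Real.rpow_nonneg (norm_nonneg _) _) fun α => ?_
    exact Real.rpow_le_rpow (norm_nonneg _) (norm_shiftFun_add_single_le j f α) (by norm_num)
  · intro β hβ
    simp [shiftFun_of_notMem_range j f β hβ]

/-- The element `z_j f` of `H²_d`. -/
def shiftElt {d : ℕ} (j : Fin d) (f : H2 d) : H2 d :=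
  ⟨shiftFun j f, memℓp_gen (by simpa using summable_shiftFun j f)⟩

theorem norm_shiftElt_le {d : ℕ} (j : Fin d) (f : H2 d) : ‖shiftElt j f‖ ≤ ‖f‖ := by
  refine lp.norm_le_of_tsum_le (by norm_num) (norm_nonneg f) ?_
  rw [lp.norm_rpow_eq_tsum (p := 2) (by norm_num) f]
  simp only [ENNReal.toReal_ofNat]
  change ∑' β, ‖shiftFun j f β‖ ^ (2 : ℝ) ≤ ∑' α, ‖f α‖ ^ (2 : ℝ)
  rw [← (injective_add_single j).tsum_eq]
  · refine Summable.tsum_le_tsum (fun α => ?_)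
      ((summable_shiftFun j f).comp_injective (injective_add_single j)) (summable_sq f)
    exact Real.rpow_le_rpow (norm_nonneg _) (norm_shiftFun_add_single_le j f α) (by norm_num)
  · intro β hβ
    by_contra h
    exact hβ (by simp [shiftFun_of_notMem_range j f β h])

/-- The operator `M_{z_j}` of multiplication by the `j`-th coordinate on `H²_d`. -/
def mulCoord {d : ℕ} (j : Fin d) : H2 d →L[ℂ] H2 d :=
  LinearMap.mkContinuous
    { toFun := shiftElt j
      map_add' := fun f g => by
        ext β
        change shiftFun j (f + g) β = shiftFun j f β + shiftFun j g β
        simp only [shiftFun, coeff, map_add]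
        split_ifs <;> ring
      map_smul' := fun c f => by
        ext β
        change shiftFun j (c • f) β = c * shiftFun j f β
        simp only [shiftFun, coeff, map_smul, smul_eq_mul]
        split_ifs <;> ring }
    1 (fun f => by simpa using norm_shiftElt_le j f)

/-- `M_{z_j}` is multiplication by `z_j`. -/
theorem toSeries_mulCoord {d : ℕ} (j : Fin d) (f : H2 d) :
    toSeries (mulCoord j f) = MvPowerSeries.X j * toSeries f := by
  ext β
  rw [mul_comm, MvPowerSeries.X, MvPowerSeries.coeff_mul_monomial, mul_one]
  change shiftFun j f β / (Real.sqrt (weight β) : ℂ) = _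
  have h : (Real.sqrt (weight β) : ℂ) ≠ 0 := by
    exact_mod_cast (Real.sqrt_pos.2 (weight_pos β)).ne'
  by_cases hj : β j = 0
  · simp [shiftFun, Finsupp.single_le_iff, hj]
  · rw [if_pos (Finsupp.single_le_iff.2 (Nat.one_le_iff_ne_zero.2 hj)), shiftFun, if_neg hj,
      mul_div_cancel_left₀ _ h, coeff]

/-- The subspace `p H²_d = {p f : f ∈ H²_d}`. -/
def polyMul {d : ℕ} (p : MvPolynomial (Fin d) ℂ) : Submodule ℂ (H2 d) where
  carrier := {g | ∃ f : H2 d, toSeries g = (p : MvPowerSeries (Fin d) ℂ) * toSeries f}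
  add_mem' := by
    rintro a b ⟨f, hf⟩ ⟨g, hg⟩
    exact ⟨f + g, by rw [map_add, map_add, hf, hg, mul_add]⟩
  zero_mem' := ⟨0, by simp⟩
  smul_mem' := by
    rintro c a ⟨f, hf⟩
    exact ⟨c • f, by rw [map_smul, map_smul, hf, mul_smul_comm]⟩

/-- `𝓗_p = H²_d ⊖ p H²_d`. -/
abbrev Hp {d : ℕ} (p : MvPolynomial (Fin d) ℂ) : Submodule ℂ (H2 d) := (polyMul p)ᗮ

/-- The compression `S_j = P_{𝓗_p} M_{z_j} |_{𝓗_p}` of the Arveson shift. -/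
def compressedShift {d : ℕ} (p : MvPolynomial (Fin d) ℂ) (j : Fin d) : Hp p →L[ℂ] Hp p :=
  (Hp p).orthogonalProjectionOnto ∘L mulCoord j ∘L (Hp p).subtypeL

/-- The tuple `(S_1^*, …, S_{d-1}^*)`, where `d = m + 1`. -/
def adjointTuple {m : ℕ} (p : MvPolynomial (Fin (m + 1)) ℂ) (j : Fin m) : Hp p →L[ℂ] Hp p :=
  ContinuousLinearMap.adjoint (compressedShift p j.castSucc)

/-- The point `(lam, μ) ∈ ℂ^{m+1}`. -/
def point {m : ℕ} (lam : EuclideanSpace ℂ (Fin m)) (μ : ℂ) : EuclideanSpace ℂ (Fin (m + 1)) :=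
  WithLp.toLp 2 (Fin.snoc (α := fun _ => ℂ) (fun i => lam i) μ)

/-- The entrywise complex conjugate of a vector. -/
def conjVec {m : ℕ} (lam : EuclideanSpace ℂ (Fin m)) : EuclideanSpace ℂ (Fin m) :=
  WithLp.toLp 2 fun i => conj (lam i)

/-- The one-variable polynomial `p(lam, ·)`. -/
def slice {m : ℕ} (p : MvPolynomial (Fin (m + 1)) ℂ) (lam : EuclideanSpace ℂ (Fin m)) :
    Polynomial ℂ :=
  MvPolynomial.aeval
    (Fin.snoc (α := fun _ => Polynomial ℂ) (fun i => Polynomial.C (lam i)) Polynomial.X) p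

/-- `k` is the vector `k_{(lam, μ)}^{(ℓ e_d)}`, that is, `⟨f, k⟩ = (∂/∂z_d)^ℓ f (lam, μ)` for all
`f ∈ H²_d`; for `ℓ = 0` this is the reproducing kernel at `(lam, μ)`. The inner product of Mathlib
is linear in its second argument. -/
def IsDerivKernel {m : ℕ} (lam : EuclideanSpace ℂ (Fin m)) (μ : ℂ) (l : ℕ) (k : H2 (m + 1)) :
    Prop :=
  ∀ f : H2 (m + 1), inner ℂ k f = iteratedDeriv l (fun t : ℂ => eval f (point lam t)) μ

open Classical in
/-- The neighbourhoods `U ⊆ 𝔹_{d-1}` of the origin over which the hypersurface `p = 0` is a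
branched cover with `n` sheets inside the ball `𝔹_d`: connected, open, invariant under complex
conjugation, and such that for every `lam ∈ U` the polynomial `p(lam, ·)` has precisely `n` roots
`μ`, counted with multiplicity, with `(lam, μ) ∈ 𝔹_d`. -/
structure IsBundleNhd {m : ℕ} (n : ℕ) (p : MvPolynomial (Fin (m + 1)) ℂ)
    (U : Set (EuclideanSpace ℂ (Fin m))) : Prop where
  isOpen : IsOpen U
  isConnected : IsConnected U
  zero_mem : 0 ∈ U
  subset_ball : U ⊆ Metric.ball 0 1
  conj_mem : ∀ lam ∈ U, conjVec lam ∈ U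
  roots_in_ball : ∀ lam ∈ U,
    (slice p lam).roots.countP (fun μ => point lam μ ∈ Metric.ball 0 1) = n

end DruryArveson

/-- The joint eigenspace `⋂_j ker (T_j - ω_j)`. -/
def jointKer {E : Type*} [NormedAddCommGroup E] [InnerProductSpace ℂ E] {m : ℕ}
    (T : Fin m → E →L[ℂ] E) (ω : EuclideanSpace ℂ (Fin m)) : Submodule ℂ E :=
  ⨅ j, LinearMap.ker ((T j - ω j • ContinuousLinearMap.id ℂ E : E →L[ℂ] E) : E →ₗ[ℂ] E)

/-- The Cowen-Douglas class `B_n(Ω)` of commuting `m`-tuples, for a domain `Ω ⊆ ℂ^m`: for `ω ∈ Ω`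
the operator `E → E ⊗ ℂ^m`, `h ↦ ((T_j - ω_j) h)_j`, has closed range and an `n`-dimensional
kernel, and these kernels together span a dense subspace. -/
structure IsCowenDouglas {E : Type*} [NormedAddCommGroup E] [InnerProductSpace ℂ E] {m : ℕ}
    (n : ℕ) (Ω : Set (EuclideanSpace ℂ (Fin m))) (T : Fin m → E →L[ℂ] E) : Prop where
  isOpen : IsOpen Ω
  isConnected : IsConnected Ω
  commute : ∀ i j, Commute (T i) (T j)
  isClosed_range : ∀ ω ∈ Ω,
    IsClosed (Set.range fun (h : E) (j : Fin m) => T j h - ω j • h)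
  finiteDimensional : ∀ ω ∈ Ω, FiniteDimensional ℂ (jointKer T ω)
  finrank_eq : ∀ ω ∈ Ω, Module.finrank ℂ (jointKer T ω) = n
  dense_span : (⨆ ω ∈ Ω, jointKer T ω).topologicalClosure = ⊤

end

/-! Fix `lam` and let `N = ∑_{j < d} (z_j - lam_j) H²_d + p H²_d`, so that the joint eigenspace of
the adjoint tuple at `conj lam` is `Nᗮ`. It contains the span `K` of the kernels attached to the `n`
zeros of `p(lam, ·)`, and two dimension counts show `Nᗮ = K`. On the one hand, the row
`(M_{z_1}, …, M_{z_d})` is a contraction, so every `f ∈ H²_d` is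
`∑ (z_j - w_j) g_j + c` for each `w` in the ball; applied successively at the `n` zeros
`w = (lam, μ)` this gives `H²_d = N + D` with `D` the polynomials of degree `< n` in `z_d`. On the
other hand, an element of `D` orthogonal to `K` is divisible by `p(lam, ·)`, hence zero. The finite
codimension of `N` also makes the column of adjoints have closed range. For the density, if `f` is
orthogonal to all kernels over a neighbourhood of the origin, then scaling `(lam, μ)` towards the
origin shows that they annihilate each homogeneous part of `f`; so `p` divides these parts, and
`f ⟂ p H²_d` forces `f = 0`. -/

section LinearAlgebra

open Polynomial

theorem aeval_mem_of_mem_invtSubmodule {R M : Type*} [CommRing R] [AddCommGroup M] [Module R M]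
    {Z : Module.End R M} {N : Submodule R M} (hN : N ∈ Z.invtSubmodule) (Q : R[X]) {x : M}
    (hx : x ∈ N) : aeval Z Q x ∈ N := by
  induction Q using Polynomial.induction_on' with
  | add P Q hP hQ => simpa only [map_add, LinearMap.add_apply] using N.add_mem hP hQ
  | monomial k a =>
    rw [aeval_monomial, Module.algebraMap_end_eq_smul_id]
    exact N.smul_mem a (Submodule.le_comap_pow_of_le_comap N hN k hx)

/-- Division with remainder by `∏ (Z - a)`, one factor at a time. -/
theorem sup_range_aeval_prod_sup_map_degreeLT_eq_top {R M : Type*} [CommRing R] [AddCommGroup M]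
    [Module R M] {Z : Module.End R M} {N : Submodule R M} (hN : N ∈ Z.invtSubmodule) (v : M)
    (s : Multiset R)
    (hs : ∀ a ∈ s, N ⊔ LinearMap.range (aeval Z (X - C a)) ⊔ R ∙ v = ⊤) :
    N ⊔ LinearMap.range (aeval Z (s.map fun a => X - C a).prod) ⊔
      (degreeLT R s.card).map (LinearMap.applyₗ v ∘ₗ (aeval Z).toLinearMap) = ⊤ := by
  induction s using Multiset.induction_on with
  | empty => simp [Module.End.one_eq_id]
  | cons a s ih =>
    nontriviality R
    set Q := (s.map fun a => X - C a).prod with hQ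
    rw [Multiset.map_cons, Multiset.prod_cons, Multiset.card_cons, mul_comm, map_mul,
      Module.End.mul_eq_comp, LinearMap.range_comp]
    set D := LinearMap.applyₗ v ∘ₗ (aeval Z).toLinearMap
    have hmem : Q ∈ degreeLT R (s.card + 1) := by
      rw [mem_degreeLT, hQ, degree_lt_iff_coeff_zero]
      intro k hk
      exact coeff_eq_zero_of_natDegree_lt (by rwa [natDegree_multiset_prod_X_sub_C_eq_card])
    rw [eq_top_iff, ← ih fun b hb => hs b (Multiset.mem_cons_of_mem hb),
      LinearMap.range_eq_map (aeval Z Q), ← hs a (Multiset.mem_cons_self a s), Submodule.map_sup,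
      Submodule.map_sup, Submodule.map_span, Set.image_singleton]
    refine sup_le (sup_le (le_sup_left.trans le_sup_left) (sup_le (sup_le ?_ ?_) ?_)) ?_
    · rintro _ ⟨x, hx, rfl⟩
      exact (le_sup_left.trans le_sup_left : N ≤ _) (aeval_mem_of_mem_invtSubmodule hN Q hx)
    · exact le_sup_right.trans le_sup_left
    · exact (Submodule.span_singleton_le_iff_mem _ _).2
        ((le_sup_right : (degreeLT R (s.card + 1)).map D ≤ _) ⟨Q, hmem, rfl⟩)
    · exact (Submodule.map_mono (degreeLT_mono s.card.le_succ)).trans le_sup_right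

end LinearAlgebra

section Hilbert

variable {𝕜 E : Type*} [RCLike 𝕜] [NormedAddCommGroup E] [InnerProductSpace 𝕜 E]

theorem finiteDimensional_and_finrank_le_of_disjoint_orthogonal {V W : Submodule 𝕜 E}
    [FiniteDimensional 𝕜 V] (h : Disjoint Vᗮ W) :
    FiniteDimensional 𝕜 W ∧ Module.finrank 𝕜 W ≤ Module.finrank 𝕜 V := by
  let P : W →ₗ[𝕜] V := V.orthogonalProjectionOnto.toLinearMap ∘ₗ W.subtype
  have hP : Function.Injective P := by
    refine (injective_iff_map_eq_zero P).2 fun w hw => Subtype.ext ?_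
    exact Submodule.disjoint_def.1 h _ (Submodule.orthogonalProjectionOnto_eq_zero_iff.1 hw) w.2
  exact ⟨.of_injective P hP, LinearMap.finrank_le_finrank_of_injective hP⟩

theorem isClosed_range_of_norm_le_on_orthogonal [CompleteSpace E] {G : Type*}
    [NormedAddCommGroup G] [NormedSpace 𝕜 G] (T : E →L[𝕜] G) (F : Submodule 𝕜 E)
    [FiniteDimensional 𝕜 F] {C : ℝ} (hT : ∀ h ∈ Fᗮ, ‖h‖ ≤ C * ‖T h‖) :
    IsClosed (LinearMap.range T.toLinearMap : Set G) := by
  have hanti : AntilipschitzWith C.toNNReal (T ∘L Fᗮ.subtypeL) :=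
    ContinuousLinearMap.antilipschitz_of_bound _ fun h =>
      (hT h h.2).trans (mul_le_mul_of_nonneg_right (Real.le_coe_toNNReal C) (norm_nonneg _))
  have hmap : IsClosed (Fᗮ.map T.toLinearMap : Set G) := by
    have := hanti.isClosed_range (T ∘L Fᗮ.subtypeL).uniformContinuous
    rwa [ContinuousLinearMap.coe_comp, Set.range_comp, Submodule.coe_subtypeL,
      Submodule.coe_subtype, Subtype.range_coe] at this
  rw [LinearMap.range_eq_map, ← F.sup_orthogonal_of_hasOrthogonalProjection, sup_comm,
    Submodule.map_sup]
  exact Submodule.isClosed_sup_finiteDimensional _ _ hmap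

/-- Decomposing `h ⟂ F` as `∑ A j y_j + f` with a norm bound from the open mapping theorem,
`‖h‖² = ∑ ⟪A j† h, y_j⟫`. -/
theorem isClosed_range_adjoint_of_iSup_range_sup_eq_top [CompleteSpace E] {ι : Type*} [Finite ι]
    (A : ι → E →L[𝕜] E) (F : Submodule 𝕜 E) [FiniteDimensional 𝕜 F]
    (hA : (⨆ j, LinearMap.range (A j).toLinearMap) ⊔ F = ⊤) :
    IsClosed (Set.range fun (h : E) (j : ι) => ContinuousLinearMap.adjoint (A j) h) := by
  classical
  cases nonempty_fintype ι
  let T : E →L[𝕜] ι → E := ContinuousLinearMap.pi fun j => ContinuousLinearMap.adjoint (A j)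
  let R : (ι → E) × F →L[𝕜] E :=
    (∑ j, A j ∘L ContinuousLinearMap.proj j).coprod F.subtypeL
  have hR : Function.Surjective R := by
    refine (LinearMap.range_eq_top (f := R.toLinearMap)).1 (eq_top_iff.2 (hA.ge.trans ?_))
    refine sup_le (iSup_le fun j => ?_) ?_
    · rintro _ ⟨x, rfl⟩
      refine ⟨(Pi.single j x, 0), ?_⟩
      simp [R, Pi.single_apply, apply_ite]
    · exact fun f hf => ⟨(0, ⟨f, hf⟩), by simp [R]⟩
  obtain ⟨M, hM, hpre⟩ := R.exists_preimage_norm_le hR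
  refine isClosed_range_of_norm_le_on_orthogonal T F (C := Fintype.card ι * M) fun h hh => ?_
  obtain ⟨⟨y, f⟩, hyf, hle⟩ := hpre h
  have hhf : inner 𝕜 h (f : E) = 0 := Submodule.inner_left_of_mem_orthogonal f.2 hh
  have hsq : (‖h‖ : 𝕜) ^ 2 = ∑ j, inner 𝕜 (T h j) (y j) := by
    rw [← inner_self_eq_norm_sq_to_K (𝕜 := 𝕜)]
    nth_rewrite 2 [← hyf]
    simp [R, T, inner_add_right, inner_sum, hhf, ContinuousLinearMap.adjoint_inner_left]
  have hmul : ‖h‖ * ‖h‖ ≤ Fintype.card ι * M * ‖T h‖ * ‖h‖ :=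
    calc ‖h‖ * ‖h‖ = ‖(‖h‖ : 𝕜) ^ 2‖ := by simp [sq]
      _ ≤ ∑ j, ‖T h j‖ * ‖y j‖ := hsq ▸ norm_sum_le_of_le _ fun j _ => norm_inner_le_norm _ _
      _ ≤ ∑ _j : ι, ‖T h‖ * (M * ‖h‖) := Finset.sum_le_sum fun j _ =>
        mul_le_mul (norm_le_pi_norm _ j)
          ((norm_le_pi_norm y j).trans ((norm_fst_le (y, f)).trans hle))
          (norm_nonneg _) (norm_nonneg _)
      _ = Fintype.card ι * M * ‖T h‖ * ‖h‖ := by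
        rw [Finset.sum_const, Finset.card_univ, nsmul_eq_mul]
        ring
  rcases (norm_nonneg h).eq_or_lt with h0 | h0
  · rw [← h0]
    positivity
  · exact le_of_mul_le_mul_right hmul h0

end Hilbert

section Polynomial

open Polynomial Filter Topology

theorem dvd_iff_eval_iterate_derivative_eq_zero {k : Type*} [Field k] [IsAlgClosed k] [CharZero k]
    {P Q : k[X]} (hP : P ≠ 0) :
    P ∣ Q ↔ ∀ μ l, l < P.rootMultiplicity μ → (derivative^[l] Q).eval μ = 0 := by
  rcases eq_or_ne Q 0 with rfl | hQ
  · simp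
  refine ⟨fun h μ l hl => isRoot_iterate_derivative_of_lt_rootMultiplicity
    (hl.trans_le (rootMultiplicity_le_rootMultiplicity_of_dvd hQ h μ)), fun H => ?_⟩
  classical
  refine (IsAlgClosed.splits P).dvd_of_roots_le_roots hP (Multiset.le_iff_count.2 fun μ => ?_)
  rw [count_roots, count_roots]
  by_contra! hlt
  exact lt_irrefl _ ((lt_rootMultiplicity_iff_isRoot_iterate_derivative hQ).2
    fun l hl => H μ l (hl.trans_lt hlt))

theorem iterate_derivative_comp_C_mul_X {R : Type*} [CommSemiring R] (P : R[X]) (s : R) (l : ℕ) :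
    derivative^[l] (P.comp (C s * X)) = C (s ^ l) * (derivative^[l] P).comp (C s * X) := by
  induction l with
  | zero => simp
  | succ l ih =>
    rw [Function.iterate_succ_apply', ih, Function.iterate_succ_apply', derivative_C_mul,
      derivative_comp, derivative_C_mul, derivative_X, mul_one, pow_succ, C_mul, mul_assoc]

theorem dvd_of_eventually_map_eval_dvd {σ 𝕜 : Type*} [NontriviallyNormedField 𝕜]
    {P Q : (MvPolynomial σ 𝕜)[X]} (hP : P.Monic) {x₀ : σ → 𝕜}
    (h : ∀ᶠ x in 𝓝 x₀, P.map (MvPolynomial.eval x) ∣ Q.map (MvPolynomial.eval x)) : P ∣ Q := by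
  rw [← modByMonic_eq_zero_iff_dvd hP]
  ext1 k
  rw [nhds_pi] at h
  obtain ⟨I, -, t, ht, hsub⟩ := Filter.mem_pi.1 h
  refine MvPolynomial.funext_set t (fun i => infinite_of_mem_nhds _ (ht i)) fun x hx => ?_
  have hdvd : P.map (MvPolynomial.eval x) ∣ Q.map (MvPolynomial.eval x) :=
    hsub fun i _ => hx i (Set.mem_univ i)
  rw [← modByMonic_eq_zero_iff_dvd (hP.map _), ← map_modByMonic _ hP] at hdvd
  rw [coeff_zero, map_zero, ← coeff_map, hdvd, coeff_zero]

end Polynomial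

section Analysis

open Filter Topology

theorem eq_zero_of_eventually_hasSum_pow_smul {𝕜 E : Type*} [NontriviallyNormedField 𝕜]
    [NormedAddCommGroup E] [NormedSpace 𝕜 E] {a : ℕ → E}
    (h : ∀ᶠ s : 𝕜 in 𝓝[≠] 0, HasSum (fun j => s ^ j • a j) 0) : a = 0 := by
  -- Multiplying by `s` makes the hypothesis hold at `s = 0` as well.
  let b : FormalMultilinearSeries 𝕜 𝕜 E := fun j =>
    ContinuousMultilinearMap.mkPiRing 𝕜 (Fin j) (Nat.casesOn j 0 a)
  have hb : HasFPowerSeriesAt (fun _ : 𝕜 => (0 : E)) b 0 := by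
    rw [hasFPowerSeriesAt_iff]
    filter_upwards [eventually_nhdsWithin_iff.1 h] with s hs
    rw [← hasSum_nat_add_iff' 1]
    rcases eq_or_ne s 0 with rfl | hs0
    · simp [b, FormalMultilinearSeries.coeff]
    · simpa [b, FormalMultilinearSeries.coeff, pow_succ', mul_smul] using (hs hs0).const_smul s
  funext j
  simpa [b, FormalMultilinearSeries.coeff] using congrArg (fun q => q.coeff (j + 1)) hb.eq_zero

/-- By the uniform boundedness principle a pointwise limit of difference quotients of representable
functionals is representable. -/
theorem exists_inner_eq_iteratedDeriv {𝕜 E : Type*} [RCLike 𝕜] [NormedAddCommGroup E]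
    [InnerProductSpace 𝕜 E] [CompleteSpace E] {Φ : E → 𝕜 → 𝕜} {U : Set 𝕜} (hU : IsOpen U)
    (hΦ : ∀ f, AnalyticOnNhd 𝕜 (Φ f) U)
    (hrep : ∀ t ∈ U, ∃ k : E, ∀ f, inner 𝕜 k f = Φ f t) (l : ℕ) :
    ∀ t ∈ U, ∃ k : E, ∀ f, inner 𝕜 k f = iteratedDeriv l (Φ f) t := by
  induction l with
  | zero => simpa using hrep
  | succ l ih =>
    choose! k hk using ih
    intro t ht
    have hlim : Tendsto (fun s (f : E) => ((s - t)⁻¹ • (innerSL 𝕜 (k s) - innerSL 𝕜 (k t))) f)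
        (𝓝[≠] t) (𝓝 fun f => iteratedDeriv (l + 1) (Φ f) t) := by
      refine tendsto_pi_nhds.2 fun f => ?_
      have hd : HasDerivAt (iteratedDeriv l (Φ f)) (iteratedDeriv (l + 1) (Φ f) t) t := by
        rw [iteratedDeriv_succ, iteratedDeriv_eq_iterate]
        exact ((hΦ f).iterated_deriv l t ht).differentiableAt.hasDerivAt
      refine (hasDerivAt_iff_tendsto_slope.1 hd).congr' ?_
      filter_upwards [nhdsWithin_le_nhds (hU.mem_nhds ht)] with s hs
      simp [slope, hk s hs, hk t ht]
    refine ⟨(InnerProductSpace.toDual 𝕜 E).symm (continuousLinearMapOfTendsto _ hlim), fun f => ?_⟩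
    rw [InnerProductSpace.toDual_symm_apply]
    rfl

theorem summable_multinomial_mul_prod_pow {ι : Type*} [Fintype ι] {x : ι → ℝ} (hx : ∀ i, 0 ≤ x i)
    (hx1 : ∑ i, x i < 1) :
    Summable fun k : ι → ℕ => (Nat.multinomial Finset.univ k : ℝ) * ∏ i, x i ^ k i := by
  classical
  have hterm (k : ι → ℕ) : 0 ≤ (Nat.multinomial Finset.univ k : ℝ) * ∏ i, x i ^ k i :=
    mul_nonneg (Nat.cast_nonneg _) (Finset.prod_nonneg fun i _ => pow_nonneg (hx i) _)
  have hsum : 0 ≤ ∑ i, x i := Finset.sum_nonneg fun i _ => hx i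
  refine summable_of_sum_le (c := (1 - ∑ i, x i)⁻¹) hterm fun u => ?_
  have hmaps (k) (hk : k ∈ u) : ∑ i, k i ∈ Finset.range (u.sup (fun k => ∑ i, k i) + 1) :=
    Finset.mem_range.2 (Nat.lt_succ_of_le (Finset.le_sup (f := fun k => ∑ i, k i) hk))
  rw [← Finset.sum_fiberwise_of_maps_to hmaps]
  calc _ ≤ ∑ j ∈ Finset.range (u.sup (fun k => ∑ i, k i) + 1), (∑ i, x i) ^ j := by
        refine Finset.sum_le_sum fun j _ => ?_
        rw [Finset.sum_pow_eq_sum_piAntidiag]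
        refine Finset.sum_le_sum_of_subset_of_nonneg (fun k hk => ?_) fun k _ _ => hterm k
        simpa using (Finset.mem_filter.1 hk).2
    _ ≤ ∑' j, (∑ i, x i) ^ j :=
        (summable_geometric_of_lt_one hsum hx1).sum_le_tsum _ fun _ _ => pow_nonneg hsum _
    _ = (1 - ∑ i, x i)⁻¹ := tsum_geometric_of_lt_one hsum hx1

theorem iteratedDeriv_polynomial_eval {𝕜 : Type*} [NontriviallyNormedField 𝕜] (P : Polynomial 𝕜)
    (l : ℕ) :
    iteratedDeriv l (fun t => P.eval t) = fun t => (Polynomial.derivative^[l] P).eval t := by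
  induction l with
  | zero => simp
  | succ l ih =>
    rw [iteratedDeriv_succ, ih, Function.iterate_succ_apply']
    exact funext fun t => Polynomial.deriv _

end Analysis

open scoped Topology

noncomputable section

namespace DruryArveson

variable {d m n : ℕ}

section PolynomialAction

theorem toSeries_injective : Function.Injective (toSeries (d := d)) := by
  intro f g h
  ext α
  rw [coe_eq f, coe_eq g, coeff, coeff, h]

theorem exists_toSeries_eq_mul (q : MvPolynomial (Fin d) ℂ) (f : H2 d) :
    ∃ g : H2 d, toSeries g = (q : MvPowerSeries (Fin d) ℂ) * toSeries f := by
  induction q using MvPolynomial.induction_on with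
  | C a =>
    refine ⟨a • f, ?_⟩
    rw [map_smul, MvPolynomial.coe_C, MvPowerSeries.smul_eq_C_mul]
  | add p q hp hq =>
    obtain ⟨g, hg⟩ := hp
    obtain ⟨g', hg'⟩ := hq
    exact ⟨g + g', by rw [map_add, hg, hg', MvPolynomial.coe_add, add_mul]⟩
  | mul_X p j hp =>
    obtain ⟨g, hg⟩ := hp
    refine ⟨mulCoord j g, ?_⟩
    rw [toSeries_mulCoord, hg, MvPolynomial.coe_mul, MvPolynomial.coe_X]
    ring

/-- The product `q f` of a polynomial and an element of `H²_d`. -/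
def mulPoly (q : MvPolynomial (Fin d) ℂ) (f : H2 d) : H2 d := (exists_toSeries_eq_mul q f).choose

theorem toSeries_mulPoly (q : MvPolynomial (Fin d) ℂ) (f : H2 d) :
    toSeries (mulPoly q f) = (q : MvPowerSeries (Fin d) ℂ) * toSeries f :=
  (exists_toSeries_eq_mul q f).choose_spec

/-- The action of the polynomial algebra on `H²_d` by multiplication operators. -/
def polyOp : MvPolynomial (Fin d) ℂ →ₐ[ℂ] Module.End ℂ (H2 d) :=
  AlgHom.ofLinearMap
    (LinearMap.mk₂ ℂ mulPoly
      (fun p q f => toSeries_injective <| by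
        simp only [map_add, toSeries_mulPoly, MvPolynomial.coe_add, add_mul])
      (fun c q f => toSeries_injective <| by
        simp only [map_smul, toSeries_mulPoly, MvPolynomial.coe_smul, smul_mul_assoc])
      (fun q f g => toSeries_injective <| by simp only [map_add, toSeries_mulPoly, mul_add])
      (fun c q f => toSeries_injective <| by
        simp only [map_smul, toSeries_mulPoly, mul_smul_comm]))
    (LinearMap.ext fun f => toSeries_injective <| by simp [toSeries_mulPoly])
    (fun p q => LinearMap.ext fun f => toSeries_injective <| by
      simp [toSeries_mulPoly, MvPolynomial.coe_mul, mul_assoc])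

theorem toSeries_polyOp (q : MvPolynomial (Fin d) ℂ) (f : H2 d) :
    toSeries (polyOp q f) = (q : MvPowerSeries (Fin d) ℂ) * toSeries f :=
  toSeries_mulPoly q f

theorem polyOp_X (j : Fin d) : polyOp (MvPolynomial.X j) = (mulCoord j).toLinearMap :=
  LinearMap.ext fun f => toSeries_injective <|
    (toSeries_polyOp _ f).trans <| by simp [toSeries_mulCoord]

theorem polyOp_comm (p q : MvPolynomial (Fin d) ℂ) (f : H2 d) :
    polyOp p (polyOp q f) = polyOp q (polyOp p f) := by
  rw [← Module.End.mul_apply, ← Module.End.mul_apply, ← map_mul, ← map_mul, mul_comm]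

theorem polyOp_X_sub_C (j : Fin d) (c : ℂ) (f : H2 d) :
    polyOp (MvPolynomial.X j - MvPolynomial.C c) f = mulCoord j f - c • f := by
  rw [map_sub, LinearMap.sub_apply, polyOp_X, ← MvPolynomial.algebraMap_eq, AlgHom.commutes,
    Module.algebraMap_end_apply, ContinuousLinearMap.coe_coe]

theorem continuous_polyOp (q : MvPolynomial (Fin d) ℂ) : Continuous (polyOp q) := by
  induction q using MvPolynomial.induction_on with
  | C a =>
    rw [← MvPolynomial.algebraMap_eq, AlgHom.commutes]
    exact continuous_const_smul a
  | add p q hp hq =>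
    rw [map_add]
    exact hp.add hq
  | mul_X p j hp =>
    rw [map_mul, polyOp_X]
    exact hp.comp (mulCoord j).continuous

theorem polyMul_eq_range (p : MvPolynomial (Fin d) ℂ) :
    polyMul p = LinearMap.range (polyOp p) := by
  refine Submodule.ext fun g => exists_congr fun f => ?_
  rw [← toSeries_polyOp, toSeries_injective.eq_iff, eq_comm]

end PolynomialAction

section Polynomials

/-- The constant function `1`. -/
def one : H2 d := lp.single 2 0 1

theorem toSeries_one : toSeries (one : H2 d) = 1 := by
  classical
  ext α
  change (one : H2 d) α / _ = _
  rw [MvPowerSeries.coeff_one, one, lp.single_apply]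
  by_cases h : α = 0
  · subst h
    simp [weight]
  · simp [h]

/-- The embedding of the polynomials in `H²_d`. -/
def ofPoly : MvPolynomial (Fin d) ℂ →ₗ[ℂ] H2 d :=
  LinearMap.applyₗ one ∘ₗ polyOp.toLinearMap

theorem polyOp_one (q : MvPolynomial (Fin d) ℂ) : polyOp q one = ofPoly q := rfl

theorem coeff_ofPoly (q : MvPolynomial (Fin d) ℂ) (α : Fin d →₀ ℕ) :
    coeff (ofPoly q) α = q.coeff α := by
  rw [coeff, ← polyOp_one, toSeries_polyOp, toSeries_one, mul_one, MvPolynomial.coeff_coe]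

theorem polyOp_ofPoly (p q : MvPolynomial (Fin d) ℂ) : polyOp p (ofPoly q) = ofPoly (p * q) := by
  rw [← polyOp_one, ← polyOp_one, map_mul, Module.End.mul_apply]

theorem ofPoly_monomial (α : Fin d →₀ ℕ) (c : ℂ) :
    ofPoly (MvPolynomial.monomial α c) = lp.single 2 α ((Real.sqrt (weight α) : ℂ) * c) := by
  classical
  ext β
  rw [coe_eq, coeff_ofPoly, MvPolynomial.coeff_monomial, lp.single_apply]
  by_cases h : α = β
  · subst h
    simp
  · simp [h, Ne.symm h]

theorem inner_ofPoly_monomial (α : Fin d →₀ ℕ) (f : H2 d) :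
    inner ℂ (ofPoly (MvPolynomial.monomial α 1)) f = (weight α : ℂ) * coeff f α := by
  rw [ofPoly_monomial, lp.inner_single_left, coe_eq, mul_one, RCLike.inner_apply',
    Complex.conj_ofReal, ← mul_assoc, ← Complex.ofReal_mul, Real.mul_self_sqrt (weight_pos α).le]

theorem hasSum_ofPoly_monomial (f : H2 d) :
    HasSum (fun α => ofPoly (MvPolynomial.monomial α (coeff f α))) f := by
  simp only [ofPoly_monomial, ← coe_eq]
  exact lp.hasSum_single ENNReal.ofNat_ne_top f

theorem denseRange_ofPoly : DenseRange (ofPoly (d := d)) := fun f =>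
  mem_closure_of_tendsto (hasSum_ofPoly_monomial f) <| .of_forall fun s => by
    rw [← map_sum]
    exact Set.mem_range_self _

theorem inner_polyOp_eq_zero {h : H2 d} {p : MvPolynomial (Fin d) ℂ}
    (H : ∀ q, inner ℂ h (ofPoly (p * q)) = 0) (f : H2 d) : inner ℂ h (polyOp p f) = 0 := by
  have hp := continuous_polyOp p
  refine congrFun (denseRange_ofPoly.equalizer (g := fun f => inner ℂ h (polyOp p f))
    (h := fun _ => 0) (by fun_prop) (by fun_prop) (funext fun q => ?_)) f
  rw [Function.comp_apply, polyOp_ofPoly, H, Function.comp_apply]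

end Polynomials

section RowContraction

theorem sum_add_single (j : Fin d) (α : Fin d →₀ ℕ) :
    ∑ i, (α + Finsupp.single j 1 : Fin d →₀ ℕ) i = (∑ i, α i) + 1 := by
  simp [Finset.sum_add_distrib, Finsupp.single_apply]

theorem prod_factorial_add_single (j : Fin d) (α : Fin d →₀ ℕ) :
    ∏ i, ((α + Finsupp.single j 1 : Fin d →₀ ℕ) i)! = (α j + 1) * ∏ i, (α i)! := by
  rw [← Finset.mul_prod_erase _ _ (Finset.mem_univ j),
    ← Finset.mul_prod_erase (f := fun i => (α i)!) _ (Finset.mem_univ j), ← mul_assoc]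
  congr 1
  · simp [Nat.factorial_succ]
  · refine Finset.prod_congr rfl fun i hi => ?_
    simp [(Finset.ne_of_mem_erase hi).symm]

theorem sum_mul_weight_add_single (j : Fin d) (α : Fin d →₀ ℕ) :
    ((∑ i, α i + 1 : ℕ) : ℝ) * weight (α + Finsupp.single j 1) = (α j + 1 : ℕ) * weight α := by
  have h : (((∑ i, α i)! : ℕ) : ℝ) ≠ 0 := by exact_mod_cast Nat.factorial_ne_zero _
  rw [weight, weight, sum_add_single, prod_factorial_add_single, Nat.factorial_succ]
  push_cast
  field_simp

theorem weight_mul_coeff_adjoint_mulCoord (j : Fin d) (f : H2 d) (α : Fin d →₀ ℕ) :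
    (weight α : ℂ) * coeff (ContinuousLinearMap.adjoint (mulCoord j) f) α =
      (weight (α + Finsupp.single j 1) : ℂ) * coeff f (α + Finsupp.single j 1) := by
  rw [← inner_ofPoly_monomial, ContinuousLinearMap.adjoint_inner_right,
    ← ContinuousLinearMap.coe_coe, ← polyOp_X, polyOp_ofPoly, MvPolynomial.X,
    MvPolynomial.monomial_mul, one_mul, add_comm, inner_ofPoly_monomial]

theorem sum_mul_coeff_mulCoord_adjoint (j : Fin d) (f : H2 d) (β : Fin d →₀ ℕ) :
    ((∑ i, β i : ℕ) : ℂ) *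
      coeff (mulCoord j (ContinuousLinearMap.adjoint (mulCoord j) f)) β = β j * coeff f β := by
  rw [coeff, toSeries_mulCoord, mul_comm (MvPowerSeries.X j), MvPowerSeries.X]
  by_cases hj : β j = 0
  · simp [MvPowerSeries.coeff_mul_monomial, Finsupp.single_le_iff, hj]
  · obtain ⟨α, rfl⟩ : ∃ α, β = α + Finsupp.single j 1 :=
      ⟨β - Finsupp.single j 1, (tsub_add_cancel_of_le
        (Finsupp.single_le_iff.2 (Nat.one_le_iff_ne_zero.2 hj))).symm⟩
    have hα : (weight α : ℂ) ≠ 0 := by exact_mod_cast (weight_pos α).ne'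
    have hw : ((∑ i, α i + 1 : ℕ) : ℂ) * weight (α + Finsupp.single j 1) =
        (α j + 1 : ℕ) * weight α := by exact_mod_cast sum_mul_weight_add_single j α
    rw [MvPowerSeries.coeff_add_mul_monomial, mul_one, sum_add_single, Finsupp.add_apply,
      Finsupp.single_eq_same]
    refine mul_left_cancel₀ hα ?_
    rw [mul_left_comm, ← coeff, weight_mul_coeff_adjoint_mulCoord, ← mul_assoc, hw]
    ring

theorem sum_mulCoord_adjoint (f : H2 d) :
    ∑ j, mulCoord j (ContinuousLinearMap.adjoint (mulCoord j) f) = f - coeff f 0 • one := by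
  classical
  refine toSeries_injective (MvPowerSeries.ext fun β => ?_)
  rw [map_sum, map_sum, map_sub, map_sub, map_smul, map_smul, toSeries_one,
    MvPowerSeries.coeff_one]
  change ∑ j, coeff _ β = coeff f β - _
  by_cases hβ : β = 0
  · subst hβ
    have hj (j : Fin d) :
        coeff (mulCoord j (ContinuousLinearMap.adjoint (mulCoord j) f)) 0 = 0 := by
      rw [coeff, toSeries_mulCoord]
      simp
    simp [hj]
  · have hsum : ((∑ i, β i : ℕ) : ℂ) ≠ 0 := by
      rw [Nat.cast_ne_zero, Ne, Finset.sum_eq_zero_iff]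
      exact fun h => hβ (Finsupp.ext fun i => h i (Finset.mem_univ i))
    rw [if_neg hβ, smul_zero, sub_zero]
    refine mul_left_cancel₀ hsum ?_
    rw [Finset.mul_sum, Finset.sum_congr rfl fun j _ => sum_mul_coeff_mulCoord_adjoint j f β,
      ← Finset.sum_mul, Nat.cast_sum]

theorem inner_one (f : H2 d) : inner ℂ one f = coeff f 0 := by
  have h := inner_ofPoly_monomial 0 f
  rwa [MvPolynomial.monomial_zero', MvPolynomial.C_1, ← polyOp_one, map_one,
    Module.End.one_apply, show weight (0 : Fin d →₀ ℕ) = 1 by simp [weight], Complex.ofReal_one,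
    one_mul] at h

theorem sum_norm_adjoint_mulCoord_sq_le (f : H2 d) :
    ∑ j, ‖ContinuousLinearMap.adjoint (mulCoord j) f‖ ^ 2 ≤ ‖f‖ ^ 2 := by
  have hsum : ∑ j, ‖ContinuousLinearMap.adjoint (mulCoord j) f‖ ^ 2 =
      RCLike.re (inner ℂ (∑ j, mulCoord j (ContinuousLinearMap.adjoint (mulCoord j) f)) f) := by
    rw [sum_inner, map_sum]
    exact Finset.sum_congr rfl fun j _ => by
      rw [← ContinuousLinearMap.adjoint_inner_right, inner_self_eq_norm_sq]
  have hconst : RCLike.re (conj (coeff f 0) * coeff f 0) = ‖coeff f 0‖ ^ 2 := by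
    rw [RCLike.conj_mul, ← RCLike.ofReal_pow, RCLike.ofReal_re]
  rw [hsum, sum_mulCoord_adjoint, inner_sub_left, inner_smul_left, inner_one, map_sub, hconst,
    inner_self_eq_norm_sq]
  exact sub_le_self _ (sq_nonneg _)

/-- Gleason's problem in the ball: the row `(M_{z_1}, …, M_{z_d})` is a contraction, so that
`1 - ∑ w_j M_{z_j}^*` is invertible for `‖w‖ < 1`. -/
theorem exists_eq_sum_sub {w : EuclideanSpace ℂ (Fin d)} (hw : ‖w‖ < 1) (f : H2 d) :
    ∃ (g : Fin d → H2 d) (c : ℂ), f = ∑ j, (mulCoord j (g j) - w j • g j) + c • one := by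
  let A : H2 d →L[ℂ] H2 d := ∑ j, w j • ContinuousLinearMap.adjoint (mulCoord j)
  have hA (f) : A f = ∑ j, w j • ContinuousLinearMap.adjoint (mulCoord j) f := by simp [A]
  have hnorm : ‖A‖ < 1 := by
    refine (ContinuousLinearMap.opNorm_le_bound _ (norm_nonneg w) fun f => ?_).trans_lt hw
    calc ‖A f‖ ≤ ∑ j, ‖w j‖ * ‖ContinuousLinearMap.adjoint (mulCoord j) f‖ := by
          rw [hA]
          exact (norm_sum_le _ _).trans_eq (Finset.sum_congr rfl fun j _ => norm_smul _ _)
      _ ≤ √(∑ j, ‖w j‖ ^ 2) * √(∑ j, ‖ContinuousLinearMap.adjoint (mulCoord j) f‖ ^ 2) :=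
          Real.sum_mul_le_sqrt_mul_sqrt _ _ _
      _ ≤ ‖w‖ * ‖f‖ := by
          rw [← EuclideanSpace.norm_eq]
          gcongr
          exact Real.sqrt_le_iff.2 ⟨norm_nonneg _, sum_norm_adjoint_mulCoord_sq_le f⟩
  obtain ⟨f, rfl⟩ := (ContinuousLinearMap.isUnit_iff_bijective.1
    (isUnit_one_sub_of_norm_lt_one hnorm)).2 f
  refine ⟨fun j => ContinuousLinearMap.adjoint (mulCoord j) f, coeff f 0, ?_⟩
  rw [Finset.sum_sub_distrib, sum_mulCoord_adjoint, ← hA, sub_apply,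
    one_apply_eq_self]
  abel

end RowContraction

section Slices

/-- Polynomials in `z_1, …, z_{m+1}` as polynomials in the last variable `z_{m+1}`. -/
def sliceEquiv : MvPolynomial (Fin (m + 1)) ℂ ≃ₐ[ℂ] Polynomial (MvPolynomial (Fin m) ℂ) :=
  (MvPolynomial.renameEquiv ℂ finSuccEquivLast).trans (MvPolynomial.optionEquivLeft ℂ (Fin m))

theorem sliceEquiv_X_castSucc (j : Fin m) :
    sliceEquiv (MvPolynomial.X j.castSucc) = Polynomial.C (MvPolynomial.X j) := by
  simp [sliceEquiv]

theorem sliceEquiv_X_last :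
    sliceEquiv (MvPolynomial.X (Fin.last m)) = Polynomial.X := by
  simp [sliceEquiv]

theorem slice_X_castSucc (lam : EuclideanSpace ℂ (Fin m)) (j : Fin m) :
    slice (MvPolynomial.X j.castSucc) lam = Polynomial.C (lam j) := by
  simp [slice]

theorem slice_X_last (lam : EuclideanSpace ℂ (Fin m)) :
    slice (MvPolynomial.X (Fin.last m)) lam = Polynomial.X := by
  simp [slice]

theorem map_sliceEquiv (p : MvPolynomial (Fin (m + 1)) ℂ) (lam : EuclideanSpace ℂ (Fin m)) :
    (sliceEquiv p).map (MvPolynomial.eval lam) = slice p lam := by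
  have h : (Polynomial.mapAlgHom (MvPolynomial.aeval (lam : Fin m → ℂ))).comp
      (sliceEquiv (m := m)).toAlgHom = MvPolynomial.aeval
        (Fin.snoc (α := fun _ => Polynomial ℂ) (fun i => Polynomial.C (lam i)) Polynomial.X) := by
    refine MvPolynomial.algHom_ext fun i => Fin.lastCases ?_ (fun i => ?_) i
    · simp [sliceEquiv_X_last]
    · simp [sliceEquiv_X_castSucc]
  simpa [MvPolynomial.coe_aeval_eq_eval, slice] using DFunLike.congr_fun h p

theorem slice_add (p q : MvPolynomial (Fin (m + 1)) ℂ) (lam : EuclideanSpace ℂ (Fin m)) :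
    slice (p + q) lam = slice p lam + slice q lam :=
  map_add _ p q

theorem slice_mul (p q : MvPolynomial (Fin (m + 1)) ℂ) (lam : EuclideanSpace ℂ (Fin m)) :
    slice (p * q) lam = slice p lam * slice q lam :=
  map_mul _ p q

theorem slice_sub_C (p : MvPolynomial (Fin (m + 1)) ℂ) (c : ℂ) (lam : EuclideanSpace ℂ (Fin m)) :
    slice (p - MvPolynomial.C c) lam = slice p lam - Polynomial.C c := by
  simp [slice]

theorem slice_aeval_X_last (P : Polynomial ℂ) (lam : EuclideanSpace ℂ (Fin m)) :
    slice (Polynomial.aeval (MvPolynomial.X (Fin.last m)) P) lam = P := by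
  rw [slice, ← Polynomial.aeval_algHom_apply, ← slice, slice_X_last, Polynomial.aeval_X_left_apply]

theorem eval_slice (q : MvPolynomial (Fin (m + 1)) ℂ) (lam : EuclideanSpace ℂ (Fin m)) (t : ℂ) :
    (slice q lam).eval t = MvPolynomial.eval (point lam t) q := by
  have h : (Polynomial.aeval t).comp (MvPolynomial.aeval
      (Fin.snoc (α := fun _ => Polynomial ℂ) (fun i => Polynomial.C (lam i)) Polynomial.X)) =
      MvPolynomial.aeval (point lam t) := by
    refine MvPolynomial.algHom_ext fun i => Fin.lastCases ?_ (fun i => ?_) i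
    · simp [point]
    · simp [point]
  simpa [MvPolynomial.aeval_eq_eval, slice] using DFunLike.congr_fun h q

theorem eval_smul_of_isHomogeneous {σ R : Type*} [CommSemiring R] {q : MvPolynomial σ R}
    (hq : q.IsHomogeneous n) (s : R) (z : σ → R) :
    MvPolynomial.eval (s • z) q = s ^ n * MvPolynomial.eval z q := by
  rw [MvPolynomial.eval_eq, MvPolynomial.eval_eq, Finset.mul_sum]
  refine Finset.sum_congr rfl fun α hα => ?_
  simp only [Pi.smul_apply, smul_eq_mul, mul_pow, Finset.prod_mul_distrib]
  rw [Finset.prod_pow_eq_pow_sum, ← hq.degree_eq_sum_deg_support hα, mul_left_comm]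

theorem smul_point (s : ℂ) (lam : EuclideanSpace ℂ (Fin m)) (t : ℂ) :
    s • point lam t = point (s • lam) (s * t) := by
  ext i
  refine Fin.lastCases ?_ (fun i => ?_) i <;> simp [point]

theorem eval_point_smul {q : MvPolynomial (Fin (m + 1)) ℂ} (hq : q.IsHomogeneous n) (s : ℂ)
    (lam : EuclideanSpace ℂ (Fin m)) (t : ℂ) :
    MvPolynomial.eval (point (s • lam) (s * t)) q = s ^ n * MvPolynomial.eval (point lam t) q := by
  rw [← eval_smul_of_isHomogeneous hq, ← smul_point, WithLp.ofLp_smul]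

theorem iterate_derivative_slice_smul {q : MvPolynomial (Fin (m + 1)) ℂ} (hq : q.IsHomogeneous n)
    (s : ℂ) (lam : EuclideanSpace ℂ (Fin m)) (μ : ℂ) (l : ℕ) :
    s ^ l * (Polynomial.derivative^[l] (slice q (s • lam))).eval (s * μ) =
      s ^ n * (Polynomial.derivative^[l] (slice q lam)).eval μ := by
  have h : (slice q (s • lam)).comp (Polynomial.C s * Polynomial.X) =
      Polynomial.C (s ^ n) * slice q lam := by
    refine Polynomial.funext fun t => ?_
    rw [Polynomial.eval_comp, Polynomial.eval_C_mul, Polynomial.eval_C_mul, Polynomial.eval_X,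
      eval_slice, eval_slice, eval_point_smul hq]
  have h' := congrArg (fun P => (Polynomial.derivative^[l] P).eval μ) h
  simpa only [iterate_derivative_comp_C_mul_X, Polynomial.iterate_derivative_C_mul,
    Polynomial.eval_mul, Polynomial.eval_C, Polynomial.eval_comp, Polynomial.eval_X] using h'

theorem point_zero_one : (point (0 : EuclideanSpace ℂ (Fin m)) 1 : Fin (m + 1) → ℂ) =
    Pi.single (Fin.last m) 1 := by
  ext i
  refine Fin.lastCases ?_ (fun i => ?_) i <;> simp [point]

section Homogeneous

variable {p : MvPolynomial (Fin (m + 1)) ℂ} (hp : p.IsHomogeneous n)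

include hp

theorem slice_zero :
    slice p 0 = Polynomial.C (MvPolynomial.eval (Pi.single (Fin.last m) 1) p) *
      Polynomial.X ^ n := by
  refine Polynomial.funext fun t => ?_
  have h := eval_point_smul hp t 0 1
  rw [smul_zero, mul_one, point_zero_one] at h
  rw [eval_slice, h, Polynomial.eval_C_mul, Polynomial.eval_pow, Polynomial.eval_X, mul_comm]

theorem natDegree_sliceEquiv_le : (sliceEquiv p).natDegree ≤ n := by
  rw [sliceEquiv, AlgEquiv.trans_apply, MvPolynomial.natDegree_optionEquivLeft]
  exact (MvPolynomial.degreeOf_le_totalDegree _ _).trans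
    (hp.rename_isHomogeneous.totalDegree_le)

variable (hpd : MvPolynomial.eval (Pi.single (Fin.last m) 1) p ≠ 0)

include hpd

theorem coeff_sliceEquiv :
    (sliceEquiv p).coeff n =
      MvPolynomial.C (MvPolynomial.eval (Pi.single (Fin.last m) 1) p) := by
  obtain ⟨c, hc⟩ : ∃ c, (sliceEquiv p).coeff n = MvPolynomial.C c := by
    have hdeg : (MvPolynomial.renameEquiv ℂ finSuccEquivLast p).totalDegree = n := by
      rw [MvPolynomial.totalDegree_renameEquiv]
      exact hp.totalDegree fun h => hpd (by rw [h, map_zero])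
    have hle : ((sliceEquiv p).coeff n).totalDegree + n ≤ n :=
      (MvPolynomial.totalDegree_coeff_optionEquivLeft_add_le _ _ _ n hdeg.ge).trans hdeg.le
    exact ⟨_, MvPolynomial.totalDegree_eq_zero_iff_eq_C.1 (by omega)⟩
  have h : (slice p 0).coeff n = c := by
    rw [← map_sliceEquiv, Polynomial.coeff_map, hc, MvPolynomial.eval_C]
  rw [hc, ← h, slice_zero hp, Polynomial.coeff_C_mul_X_pow, if_pos rfl]

theorem natDegree_slice (lam : EuclideanSpace ℂ (Fin m)) : (slice p lam).natDegree = n := by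
  rw [← map_sliceEquiv]
  refine le_antisymm (Polynomial.natDegree_map_le.trans (natDegree_sliceEquiv_le hp))
    (Polynomial.le_natDegree_of_ne_zero ?_)
  rwa [Polynomial.coeff_map, coeff_sliceEquiv hp hpd, MvPolynomial.eval_C]

theorem slice_ne_zero (lam : EuclideanSpace ℂ (Fin m)) : slice p lam ≠ 0 := by
  intro h
  have hc : (slice p lam).coeff n ≠ 0 := by
    rwa [← map_sliceEquiv, Polynomial.coeff_map, coeff_sliceEquiv hp hpd, MvPolynomial.eval_C]
  rw [h, Polynomial.coeff_zero] at hc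
  exact hc rfl

theorem lt_rootMultiplicity_slice_smul {lam : EuclideanSpace ℂ (Fin m)} {μ : ℂ} {l : ℕ}
    (hl : l < (slice p lam).rootMultiplicity μ) {s : ℂ} (hs : s ≠ 0) :
    l < (slice p (s • lam)).rootMultiplicity (s * μ) := by
  rw [Polynomial.lt_rootMultiplicity_iff_isRoot_iterate_derivative (slice_ne_zero hp hpd _)]
    at hl ⊢
  intro i hi
  have h := iterate_derivative_slice_smul hp s lam μ i
  rw [(hl i hi : _ = _), mul_zero, mul_eq_zero] at h
  exact h.resolve_left (pow_ne_zero _ hs)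

theorem dvd_of_eventually_slice_dvd {lam₀ : EuclideanSpace ℂ (Fin m)}
    {q : MvPolynomial (Fin (m + 1)) ℂ} (h : ∀ᶠ lam in 𝓝 lam₀, slice p lam ∣ slice q lam) :
    p ∣ q := by
  set c := MvPolynomial.eval (Pi.single (Fin.last m) 1) p
  have hmul : Polynomial.C (MvPolynomial.C c⁻¹) * sliceEquiv p ∣ sliceEquiv q := by
    refine dvd_of_eventually_map_eval_dvd (x₀ := lam₀.ofLp) ?_ ?_
    · refine Polynomial.monic_of_natDegree_le_of_coeff_eq_one n
        ((Polynomial.natDegree_C_mul_le _ _).trans (natDegree_sliceEquiv_le hp)) ?_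
      rw [Polynomial.coeff_C_mul, coeff_sliceEquiv hp hpd, ← map_mul, inv_mul_cancel₀ hpd, map_one]
    · have h' := (PiLp.continuous_toLp 2 fun _ : Fin m => ℂ).continuousAt.eventually h
      filter_upwards [h'] with x hx
      rw [← map_sliceEquiv, ← map_sliceEquiv] at hx
      rw [Polynomial.map_mul, Polynomial.map_C, MvPolynomial.eval_C]
      exact (Polynomial.isUnit_C.2 (inv_ne_zero hpd).isUnit).mul_left_dvd.2 hx
  rw [← map_dvd_iff (sliceEquiv (m := m))]
  exact dvd_of_mul_left_dvd hmul

end Homogeneous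

end Slices

section Evaluation

theorem inv_weight_eq_multinomial (α : Fin d →₀ ℕ) :
    (weight α)⁻¹ = Nat.multinomial Finset.univ α := by
  have h : (0 : ℝ) < ((∏ i, (α i)! : ℕ) : ℝ) := by
    exact_mod_cast Finset.prod_pos fun i _ => Nat.factorial_pos _
  rw [weight, inv_div, div_eq_iff h.ne', mul_comm]
  exact_mod_cast (Nat.multinomial_spec Finset.univ α).symm

/-- The coordinates `conj (z^α) / ‖z^α‖` of the reproducing kernel at `z` with respect to the
orthonormal basis `z^α / ‖z^α‖`. -/
def kernelFun (z : EuclideanSpace ℂ (Fin d)) (α : Fin d →₀ ℕ) : ℂ :=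
  conj (∏ i, z i ^ α i) / (Real.sqrt (weight α) : ℂ)

theorem norm_kernelFun_sq (z : EuclideanSpace ℂ (Fin d)) (α : Fin d →₀ ℕ) :
    ‖kernelFun z α‖ ^ 2 = Nat.multinomial Finset.univ α * ∏ i, (‖z i‖ ^ 2) ^ α i := by
  rw [kernelFun, norm_div, RCLike.norm_conj, norm_prod, Complex.norm_real,
    Real.norm_of_nonneg (Real.sqrt_nonneg _), div_pow, Real.sq_sqrt (weight_pos α).le,
    div_eq_inv_mul, inv_weight_eq_multinomial, ← Finset.prod_pow]
  simp only [norm_pow, ← pow_mul, mul_comm]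

theorem memℓp_kernelFun {z : EuclideanSpace ℂ (Fin d)} (hz : ‖z‖ < 1) : Memℓp (kernelFun z) 2 := by
  refine memℓp_gen ?_
  have h : ∑ i, ‖z i‖ ^ 2 < 1 := by
    rw [← EuclideanSpace.norm_sq_eq]
    exact pow_lt_one₀ (norm_nonneg _) hz two_ne_zero
  simp only [ENNReal.toReal_ofNat, Real.rpow_two, norm_kernelFun_sq]
  exact (summable_multinomial_mul_prod_pow (fun i => sq_nonneg ‖z i‖) h).comp_injective
    (i := fun α : Fin d →₀ ℕ => (α : Fin d → ℕ)) DFunLike.coe_injective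

/-- The reproducing kernel at a point `z` of the unit ball. -/
def kernel (z : EuclideanSpace ℂ (Fin d)) (hz : ‖z‖ < 1) : H2 d := ⟨kernelFun z, memℓp_kernelFun hz⟩

theorem inner_kernel_apply {z : EuclideanSpace ℂ (Fin d)} (hz : ‖z‖ < 1) (f : H2 d)
    (α : Fin d →₀ ℕ) : inner ℂ (kernel z hz α) (f α) = coeff f α * ∏ i, z i ^ α i := by
  change inner ℂ (kernelFun z α) (f α) = _
  rw [RCLike.inner_apply, kernelFun, coeff_def, map_div₀, Complex.conj_conj, Complex.conj_ofReal]
  ring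

theorem inner_kernel {z : EuclideanSpace ℂ (Fin d)} (hz : ‖z‖ < 1) (f : H2 d) :
    inner ℂ (kernel z hz) f = eval f z := by
  rw [lp.inner_eq_tsum]
  exact tsum_congr (inner_kernel_apply hz f)

theorem summable_norm_coeff_mul {z : EuclideanSpace ℂ (Fin d)} (hz : ‖z‖ < 1) (f : H2 d) :
    Summable fun α => ‖coeff f α * ∏ i, z i ^ α i‖ :=
  ((lp.summable_inner (kernel z hz) f).congr (inner_kernel_apply hz f)).norm

theorem eval_ofPoly (q : MvPolynomial (Fin d) ℂ) (z : EuclideanSpace ℂ (Fin d)) :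
    eval (ofPoly q) z = MvPolynomial.eval z q := by
  rw [eval, MvPolynomial.eval_eq', tsum_eq_sum (s := q.support)]
  · simp only [coeff_ofPoly]
  · intro α hα
    rw [coeff_ofPoly, MvPolynomial.notMem_support_iff.1 hα, zero_mul]

theorem norm_point_sq (lam : EuclideanSpace ℂ (Fin m)) (μ : ℂ) :
    ‖point lam μ‖ ^ 2 = ‖lam‖ ^ 2 + ‖μ‖ ^ 2 := by
  rw [EuclideanSpace.norm_sq_eq, EuclideanSpace.norm_sq_eq, Fin.sum_univ_castSucc]
  simp [point]

theorem norm_point_lt_one_iff {lam : EuclideanSpace ℂ (Fin m)} {μ : ℂ} :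
    ‖point lam μ‖ < 1 ↔ ‖lam‖ ^ 2 + ‖μ‖ ^ 2 < 1 := by
  rw [← norm_point_sq, sq_lt_one_iff₀ (norm_nonneg _)]

theorem differentiableOn_eval_point (f : H2 (m + 1)) {lam : EuclideanSpace ℂ (Fin m)} {R : ℝ}
    (hR : ‖point lam (R : ℂ)‖ < 1) :
    DifferentiableOn ℂ (fun t => eval f (point lam t)) (Metric.ball 0 R) := by
  refine Complex.differentiableOn_tsum_of_summable_norm (summable_norm_coeff_mul hR f)
    (fun α => ?_) Metric.isOpen_ball fun α t ht => ?_
  · simp only [Fin.prod_univ_castSucc, point, Fin.snoc_castSucc, Fin.snoc_last]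
    fun_prop
  · have hle : ‖t‖ ≤ ‖(R : ℂ)‖ := by
      rw [Complex.norm_real]
      exact (mem_ball_zero_iff.1 ht).le.trans (le_abs_self R)
    simp only [point, Fin.prod_univ_castSucc, Fin.snoc_castSucc, Fin.snoc_last, norm_mul, norm_pow]
    gcongr

theorem analyticOnNhd_eval_point (f : H2 (m + 1)) (lam : EuclideanSpace ℂ (Fin m)) :
    AnalyticOnNhd ℂ (fun t => eval f (point lam t)) {t | ‖point lam t‖ < 1} := by
  intro t ht
  have hlim : Filter.Tendsto (fun R : ℝ => ‖lam‖ ^ 2 + R ^ 2) (𝓝[>] ‖t‖)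
      (𝓝 (‖lam‖ ^ 2 + ‖t‖ ^ 2)) :=
    ((by fun_prop : Continuous fun R : ℝ => ‖lam‖ ^ 2 + R ^ 2).tendsto _).mono_left
      nhdsWithin_le_nhds
  obtain ⟨R, hR, htR⟩ := ((hlim.eventually_lt_const (norm_point_lt_one_iff.1 ht)).and
    self_mem_nhdsWithin).exists
  refine (differentiableOn_eval_point f (R := R) (norm_point_lt_one_iff.2 ?_)).analyticAt
    (Metric.isOpen_ball.mem_nhds (mem_ball_zero_iff.2 htR))
  rwa [Complex.norm_real, Real.norm_eq_abs, sq_abs]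

theorem exists_isDerivKernel {lam : EuclideanSpace ℂ (Fin m)} {μ : ℂ} (h : ‖point lam μ‖ < 1)
    (l : ℕ) : ∃ k, IsDerivKernel lam μ l k := by
  have hU : IsOpen {t : ℂ | ‖point lam t‖ < 1} := by
    simp only [norm_point_lt_one_iff]
    exact isOpen_lt (by fun_prop) continuous_const
  exact exists_inner_eq_iteratedDeriv hU (fun f => analyticOnNhd_eval_point f lam)
    (fun t ht => ⟨kernel _ ht, inner_kernel ht⟩) l μ h

theorem IsDerivKernel.inner_ofPoly {lam : EuclideanSpace ℂ (Fin m)} {μ : ℂ} {l : ℕ}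
    {k : H2 (m + 1)} (hk : IsDerivKernel lam μ l k) (q : MvPolynomial (Fin (m + 1)) ℂ) :
    inner ℂ k (ofPoly q) = (Polynomial.derivative^[l] (slice q lam)).eval μ := by
  rw [hk]
  simp only [eval_ofPoly, ← eval_slice]
  rw [iteratedDeriv_polynomial_eval]

end Evaluation

section JointKernel

open MvPolynomial

theorem polyOp_mem_polyMul (p q : MvPolynomial (Fin d) ℂ) {f : H2 d} (hf : f ∈ polyMul p) :
    polyOp q f ∈ polyMul p := by
  rw [polyMul_eq_range] at hf ⊢
  obtain ⟨g, rfl⟩ := hf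
  exact ⟨polyOp q g, polyOp_comm p q g⟩

theorem adjoint_mulCoord_mem (p : MvPolynomial (Fin d) ℂ) (j : Fin d) {h : H2 d}
    (hh : h ∈ Hp p) : ContinuousLinearMap.adjoint (mulCoord j) h ∈ Hp p := by
  rw [Submodule.mem_orthogonal'] at hh ⊢
  intro g hg
  rw [ContinuousLinearMap.adjoint_inner_left]
  refine hh _ ?_
  simpa only [polyOp_X, ContinuousLinearMap.coe_coe] using polyOp_mem_polyMul p (X j) hg

theorem coe_adjoint_compressedShift (p : MvPolynomial (Fin d) ℂ) (j : Fin d) (h : Hp p) :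
    (ContinuousLinearMap.adjoint (compressedShift p j) h : H2 d) =
      ContinuousLinearMap.adjoint (mulCoord j) (h : H2 d) := by
  suffices ContinuousLinearMap.adjoint (compressedShift p j) h =
      ⟨_, adjoint_mulCoord_mem p j h.2⟩ by rw [this]
  refine ext_inner_right ℂ fun y => ?_
  rw [ContinuousLinearMap.adjoint_inner_left, Submodule.coe_inner, Submodule.coe_inner,
    ContinuousLinearMap.adjoint_inner_left]
  exact Submodule.inner_orthogonalProjectionOnto_eq_of_mem_left h (mulCoord j y)

theorem mulCoord_comm (i j : Fin d) (f : H2 d) :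
    mulCoord i (mulCoord j f) = mulCoord j (mulCoord i f) := by
  simpa only [polyOp_X, ContinuousLinearMap.coe_coe] using polyOp_comm (X i) (X j) f

theorem commute_adjointTuple (p : MvPolynomial (Fin (m + 1)) ℂ) (i j : Fin m) :
    Commute (adjointTuple p i) (adjointTuple p j) := by
  refine ContinuousLinearMap.ext fun h => Subtype.ext ?_
  simp only [mul_apply_eq_comp, adjointTuple, coe_adjoint_compressedShift]
  refine ext_inner_right ℂ fun y => ?_
  simp only [ContinuousLinearMap.adjoint_inner_left]
  rw [mulCoord_comm]

/-- The subspace `∑_{j < d} (z_j - lam_j) H²_d + p H²_d`, not closed a priori: its orthogonal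
complement is the joint eigenspace of the adjoint tuple at `conj lam`. -/
def sliceRange (p : MvPolynomial (Fin (m + 1)) ℂ) (lam : EuclideanSpace ℂ (Fin m)) :
    Submodule ℂ (H2 (m + 1)) :=
  (⨆ j : Fin m, LinearMap.range (polyOp (X j.castSucc - C (lam j)))) ⊔ polyMul p

theorem mem_orthogonal_range_polyOp_X_sub_C {j : Fin d} {c : ℂ} {h : H2 d} :
    h ∈ (LinearMap.range (polyOp (X j - C c)))ᗮ ↔
      ContinuousLinearMap.adjoint (mulCoord j) h - conj c • h = 0 := by
  have inner_polyOp (f : H2 d) : inner ℂ h (polyOp (X j - C c) f) =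
      inner ℂ (ContinuousLinearMap.adjoint (mulCoord j) h - conj c • h) f := by
    rw [polyOp_X_sub_C, inner_sub_right, inner_sub_left, inner_smul_right, inner_smul_left,
      ContinuousLinearMap.adjoint_inner_left, Complex.conj_conj]
  rw [Submodule.mem_orthogonal', ← inner_self_eq_zero (𝕜 := ℂ)]
  constructor
  · exact fun H => (inner_polyOp _).symm.trans (H _ ⟨_, rfl⟩)
  · rintro H _ ⟨f, rfl⟩
    rw [inner_polyOp, inner_self_eq_zero.1 H, inner_zero_left]

theorem map_jointKer_eq (p : MvPolynomial (Fin (m + 1)) ℂ) (lam : EuclideanSpace ℂ (Fin m)) :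
    (jointKer (adjointTuple p) (conjVec lam)).map (Hp p).subtype = (sliceRange p lam)ᗮ := by
  have comap_eq : jointKer (adjointTuple p) (conjVec lam) =
      (⨅ j : Fin m, (LinearMap.range (polyOp (X j.castSucc - C (lam j))))ᗮ).comap
        (Hp p).subtype := by
    ext h
    simp only [jointKer, Submodule.mem_iInf, Submodule.mem_comap, Submodule.subtype_apply,
      mem_orthogonal_range_polyOp_X_sub_C]
    refine forall_congr' fun j => ?_
    rw [← coe_adjoint_compressedShift]
    exact Subtype.ext_iff
  rw [comap_eq, Submodule.map_comap_subtype, Submodule.iInf_orthogonal, inf_comm,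
    Submodule.inf_orthogonal, sliceRange]

end JointKernel

section Fibre

open MvPolynomial

variable {p : MvPolynomial (Fin (m + 1)) ℂ} {lam : EuclideanSpace ℂ (Fin m)}

theorem polyOp_mem_sliceRange (q : MvPolynomial (Fin (m + 1)) ℂ) {f : H2 (m + 1)}
    (hf : f ∈ sliceRange p lam) : polyOp q f ∈ sliceRange p lam := by
  suffices (sliceRange p lam).map (polyOp q) ≤ sliceRange p lam from
    this (Submodule.mem_map_of_mem hf)
  rw [sliceRange, Submodule.map_sup, Submodule.map_iSup]
  refine sup_le_sup (iSup_mono fun j => ?_) ?_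
  · rintro _ ⟨_, ⟨g, rfl⟩, rfl⟩
    exact ⟨polyOp q g, polyOp_comm _ q g⟩
  · rintro _ ⟨g, hg, rfl⟩
    exact polyOp_mem_polyMul p q hg

theorem sliceRange_sup_range_sup_span_one (p : MvPolynomial (Fin (m + 1)) ℂ) {μ : ℂ}
    (h : ‖point lam μ‖ < 1) :
    sliceRange p lam ⊔ LinearMap.range (polyOp (X (Fin.last m) - C μ)) ⊔ ℂ ∙ one = ⊤ := by
  rw [eq_top_iff]
  rintro f -
  obtain ⟨g, c, rfl⟩ := exists_eq_sum_sub h f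
  refine add_mem (Submodule.mem_sup_left ?_)
    (Submodule.mem_sup_right (Submodule.smul_mem _ _ (Submodule.mem_span_singleton_self _)))
  simp only [← polyOp_X_sub_C, Fin.sum_univ_castSucc]
  refine add_mem (Submodule.mem_sup_left (Submodule.mem_sup_left (sum_mem fun j _ => ?_)))
    (Submodule.mem_sup_right ⟨g (Fin.last m), ?_⟩)
  · exact Submodule.mem_iSup_of_mem j ⟨g j.castSucc, by simp [point]⟩
  · simp [point]

theorem polyOp_sub_aeval_slice_mem_sliceRange (q : MvPolynomial (Fin (m + 1)) ℂ)
    (f : H2 (m + 1)) :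
    polyOp (q - Polynomial.aeval (X (Fin.last m)) (slice q lam)) f ∈ sliceRange p lam := by
  induction q using MvPolynomial.induction_on generalizing f with
  | C a => simp [slice, MvPolynomial.algebraMap_eq]
  | add q r hq hr =>
    rw [slice_add, map_add, add_sub_add_comm, map_add]
    exact add_mem (hq f) (hr f)
  | mul_X q i hq =>
    set q' : MvPolynomial (Fin (m + 1)) ℂ :=
      Polynomial.aeval (X (Fin.last m)) (slice q lam)
    set x : MvPolynomial (Fin (m + 1)) ℂ :=
      Polynomial.aeval (X (Fin.last m)) (slice (X i) lam) with hx
    have expand : q * X i - q' * x = x * (q - q') + (X i - x) * q := by ring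
    rw [slice_mul, map_mul, expand, map_add, map_mul, map_mul]
    refine add_mem (polyOp_mem_sliceRange x (hq f)) ?_
    rw [hx, Module.End.mul_apply]
    cases i using Fin.lastCases with
    | last => simp [slice_X_last]
    | cast j =>
      rw [slice_X_castSucc, Polynomial.aeval_C, MvPolynomial.algebraMap_eq]
      exact Submodule.mem_sup_left (Submodule.mem_iSup_of_mem j ⟨_, rfl⟩)

/-- Polynomials in one variable, viewed as functions of the last coordinate in `H²_d`. -/
def ofLastPoly : Polynomial ℂ →ₗ[ℂ] H2 (m + 1) :=
  ofPoly ∘ₗ (Polynomial.aeval (X (Fin.last m) : MvPolynomial (Fin (m + 1)) ℂ)).toLinearMap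

theorem sliceRange_sup_map_ofLastPoly_eq_top (h0 : slice p lam ≠ 0)
    (hball : ∀ μ ∈ (slice p lam).roots, ‖point lam μ‖ < 1) :
    sliceRange p lam ⊔
      (Polynomial.degreeLT ℂ (slice p lam).natDegree).map ofLastPoly = ⊤ := by
  let Z : Module.End ℂ (H2 (m + 1)) := polyOp (X (Fin.last m))
  have aeval_Z (P : Polynomial ℂ) :
      Polynomial.aeval Z P = polyOp (Polynomial.aeval (X (Fin.last m)) P) :=
    Polynomial.aeval_algHom_apply ..
  have ofLastPoly_eq : (ofLastPoly : _ →ₗ[ℂ] H2 (m + 1)) =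
      LinearMap.applyₗ one ∘ₗ (Polynomial.aeval Z).toLinearMap :=
    LinearMap.ext fun P => by simp [aeval_Z, ofLastPoly, polyOp_one]
  have range_le : LinearMap.range
      (Polynomial.aeval Z ((slice p lam).roots.map fun a => Polynomial.X - Polynomial.C a).prod) ≤
        sliceRange p lam := by
    rintro _ ⟨f, rfl⟩
    have hlead := Polynomial.leadingCoeff_ne_zero.2 h0
    have hp : Polynomial.aeval Z (slice p lam) f ∈ sliceRange p lam := by
      rw [aeval_Z, ← sub_sub_cancel p (Polynomial.aeval _ _), map_sub]
      exact sub_mem (Submodule.mem_sup_right (polyMul_eq_range p ▸ ⟨f, rfl⟩))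
        (polyOp_sub_aeval_slice_mem_sliceRange p f)
    rw [(IsAlgClosed.splits (slice p lam)).eq_prod_roots, map_mul, Polynomial.aeval_C] at hp
    exact (Submodule.smul_mem_iff _ hlead).1 hp
  have htop := sup_range_aeval_prod_sup_map_degreeLT_eq_top (Z := Z)
    (fun _ hf => polyOp_mem_sliceRange _ hf) one (slice p lam).roots fun μ hμ => by
      simpa [aeval_Z, MvPolynomial.algebraMap_eq] using
        sliceRange_sup_range_sup_span_one p (hball μ hμ)
  rwa [sup_eq_left.2 range_le, ← ofLastPoly_eq,
    ← (IsAlgClosed.splits (slice p lam)).natDegree_eq_card_roots] at htop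

/-- The kernels `k_{(lam, μ)}^{(l)}` at the zeros of `p(lam, ·)`, with `l` below the
multiplicity. -/
def derivKernels (p : MvPolynomial (Fin (m + 1)) ℂ) (lam : EuclideanSpace ℂ (Fin m)) :
    Set (H2 (m + 1)) :=
  {k | ∃ (μ : ℂ) (l : ℕ), l < (slice p lam).rootMultiplicity μ ∧ IsDerivKernel lam μ l k}

theorem inner_polyOp_eq_zero_of_mem_derivKernels (h0 : slice p lam ≠ 0) {k : H2 (m + 1)}
    (hk : k ∈ derivKernels p lam) {q : MvPolynomial (Fin (m + 1)) ℂ}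
    (hq : slice p lam ∣ slice q lam) (f : H2 (m + 1)) : inner ℂ k (polyOp q f) = 0 := by
  obtain ⟨μ, l, hl, hk⟩ := hk
  refine inner_polyOp_eq_zero (fun r => ?_) f
  rw [hk.inner_ofPoly]
  refine (dvd_iff_eval_iterate_derivative_eq_zero h0).1 ?_ μ l hl
  rw [slice_mul]
  exact hq.mul_right _

theorem span_derivKernels_le (h0 : slice p lam ≠ 0) :
    Submodule.span ℂ (derivKernels p lam) ≤ (sliceRange p lam)ᗮ := by
  refine Submodule.span_le.2 fun k hk => ?_
  rw [sliceRange, ← Submodule.inf_orthogonal, ← Submodule.iInf_orthogonal, polyMul_eq_range]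
  refine ⟨Submodule.mem_iInf _ |>.2 fun j => ?_, ?_⟩ <;>
    refine (Submodule.mem_orthogonal' _ _).2 ?_ <;> rintro _ ⟨f, rfl⟩ <;>
    refine inner_polyOp_eq_zero_of_mem_derivKernels h0 hk ?_ f
  · rw [slice_sub_C, slice_X_castSucc, sub_self]
    exact dvd_zero _
  · rfl

theorem eq_zero_of_ofLastPoly_mem_orthogonal
    (hball : ∀ μ ∈ (slice p lam).roots, ‖point lam μ‖ < 1) {P : Polynomial ℂ}
    (hP : P ∈ Polynomial.degreeLT ℂ (slice p lam).natDegree)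
    (horth : ofLastPoly P ∈ (Submodule.span ℂ (derivKernels p lam))ᗮ) : P = 0 := by
  rcases eq_or_ne (slice p lam) 0 with h0 | h0
  · exact Polynomial.ext (by simpa [h0, Polynomial.degreeLT] using hP)
  refine Polynomial.eq_zero_of_dvd_of_degree_lt
    ((dvd_iff_eval_iterate_derivative_eq_zero h0).2 fun μ l hl => ?_)
    (by simpa [Polynomial.degree_eq_natDegree h0] using Polynomial.mem_degreeLT.1 hP)
  have hμ : μ ∈ (slice p lam).roots :=
    Multiset.count_pos.1 (by rw [Polynomial.count_roots]; exact l.zero_le.trans_lt hl)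
  obtain ⟨k, hk⟩ := exists_isDerivKernel (hball μ hμ) l
  rw [← slice_aeval_X_last P lam, ← hk.inner_ofPoly]
  exact (Submodule.mem_orthogonal _ _).1 horth k (Submodule.subset_span ⟨μ, l, hl, hk⟩)

theorem finrank_map_ofLastPoly (hball : ∀ μ ∈ (slice p lam).roots, ‖point lam μ‖ < 1) :
    Module.finrank ℂ ((Polynomial.degreeLT ℂ (slice p lam).natDegree).map
      (ofLastPoly : _ →ₗ[ℂ] H2 (m + 1))) = (slice p lam).natDegree := by
  have ofLastPoly_injOn : Function.Injective ((ofLastPoly : _ →ₗ[ℂ] H2 (m + 1)).domRestrict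
      (Polynomial.degreeLT ℂ (slice p lam).natDegree)) := by
    refine (injective_iff_map_eq_zero _).2 fun P hP => Subtype.ext ?_
    refine eq_zero_of_ofLastPoly_mem_orthogonal hball P.2 ?_
    rw [← LinearMap.domRestrict_apply, hP]
    exact zero_mem _
  rw [← LinearMap.range_domRestrict, LinearMap.finrank_range_of_inj ofLastPoly_injOn,
    (Polynomial.degreeLTEquiv ℂ _).finrank_eq, Module.finrank_fin_fun]

/-- With `N = sliceRange`, `K` the span of the kernels and `D` the polynomials of degree `< n` in
`z_d`: `K ⊆ Nᗮ`, while `N + D = H²_d` and `Kᗮ ∩ D = 0` give `dim Nᗮ ≤ dim D ≤ dim K`. -/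
theorem orthogonal_sliceRange_eq_span (h0 : slice p lam ≠ 0)
    (hball : ∀ μ ∈ (slice p lam).roots, ‖point lam μ‖ < 1) :
    FiniteDimensional ℂ (sliceRange p lam)ᗮ ∧
      Module.finrank ℂ (sliceRange p lam)ᗮ = (slice p lam).natDegree ∧
      (sliceRange p lam)ᗮ = Submodule.span ℂ (derivKernels p lam) := by
  set K := Submodule.span ℂ (derivKernels p lam)
  set D : Submodule ℂ (H2 (m + 1)) :=
    (Polynomial.degreeLT ℂ (slice p lam).natDegree).map ofLastPoly
  have K_le : K ≤ (sliceRange p lam)ᗮ := span_derivKernels_le h0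
  have disjoint_D_N : Disjoint Dᗮ (sliceRange p lam)ᗮ := by
    rw [disjoint_iff, Submodule.inf_orthogonal, sup_comm,
      sliceRange_sup_map_ofLastPoly_eq_top h0 hball, Submodule.top_orthogonal_eq_bot]
  have disjoint_K_D : Disjoint Kᗮ D := by
    refine Submodule.disjoint_def.2 ?_
    rintro _ hK ⟨P, hP, rfl⟩
    rw [eq_zero_of_ofLastPoly_mem_orthogonal hball hP hK, map_zero]
  obtain ⟨finite_N, finrank_N_le⟩ :=
    finiteDimensional_and_finrank_le_of_disjoint_orthogonal disjoint_D_N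
  have : FiniteDimensional ℂ K := Submodule.finiteDimensional_of_le K_le
  have finrank_D_le := (finiteDimensional_and_finrank_le_of_disjoint_orthogonal disjoint_K_D).2
  have finrank_K_le := Submodule.finrank_mono K_le
  have finrank_D : Module.finrank ℂ D = _ := finrank_map_ofLastPoly hball
  exact ⟨finite_N, by omega, (Submodule.eq_of_le_of_finrank_le K_le (by omega)).symm⟩

end Fibre

section ClosedRange

open MvPolynomial

variable {p : MvPolynomial (Fin (m + 1)) ℂ} {lam : EuclideanSpace ℂ (Fin m)}

theorem orthogonalProjectionOnto_mulCoord (p : MvPolynomial (Fin d) ℂ) (j : Fin d) (f : H2 d) :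
    (Hp p).orthogonalProjectionOnto (mulCoord j f) =
      compressedShift p j ((Hp p).orthogonalProjectionOnto f) := by
  refine ext_inner_left ℂ fun y => ?_
  rw [Submodule.inner_orthogonalProjectionOnto_eq_of_mem_left,
    ← ContinuousLinearMap.adjoint_inner_left, ← coe_adjoint_compressedShift,
    ← Submodule.inner_orthogonalProjectionOnto_eq_of_mem_left,
    ContinuousLinearMap.adjoint_inner_left]

theorem map_orthogonalProjectionOnto_sliceRange_le (p : MvPolynomial (Fin (m + 1)) ℂ)
    (lam : EuclideanSpace ℂ (Fin m)) :
    (sliceRange p lam).map (Hp p).orthogonalProjectionOnto.toLinearMap ≤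
      ⨆ j : Fin m, LinearMap.range (compressedShift p j.castSucc -
        lam j • ContinuousLinearMap.id ℂ (Hp p)).toLinearMap := by
  rw [sliceRange, Submodule.map_sup, Submodule.map_iSup]
  refine sup_le (iSup_mono fun j => ?_) ?_
  · rintro _ ⟨_, ⟨f, rfl⟩, rfl⟩
    refine ⟨(Hp p).orthogonalProjectionOnto f, ?_⟩
    rw [polyOp_X_sub_C, ContinuousLinearMap.coe_coe, ContinuousLinearMap.coe_coe, map_sub,
      map_smul, orthogonalProjectionOnto_mulCoord]
    rfl
  · rintro _ ⟨f, hf, rfl⟩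
    rw [ContinuousLinearMap.coe_coe, Submodule.orthogonalProjectionOnto_eq_zero_iff.2
      (Submodule.le_orthogonal_orthogonal _ hf)]
    exact zero_mem _

theorem isClosed_range_adjointTuple (h0 : slice p lam ≠ 0)
    (hball : ∀ μ ∈ (slice p lam).roots, ‖point lam μ‖ < 1) :
    IsClosed (Set.range fun (h : Hp p) (j : Fin m) =>
      adjointTuple p j h - conj (lam j) • h) := by
  let P : H2 (m + 1) →ₗ[ℂ] Hp p := (Hp p).orthogonalProjectionOnto.toLinearMap
  have range_P : LinearMap.range P = ⊤ := LinearMap.range_eq_top.2 fun h =>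
    ⟨h, Submodule.orthogonalProjectionOnto_mem_subspace_eq_self h⟩
  have htop : (⨆ j : Fin m, LinearMap.range (compressedShift p j.castSucc -
      lam j • ContinuousLinearMap.id ℂ (Hp p)).toLinearMap) ⊔
        ((Polynomial.degreeLT ℂ (slice p lam).natDegree).map ofLastPoly).map P = ⊤ := by
    rw [eq_top_iff, ← range_P, LinearMap.range_eq_map,
      ← sliceRange_sup_map_ofLastPoly_eq_top h0 hball, Submodule.map_sup]
    exact sup_le_sup_right (map_orthogonalProjectionOnto_sliceRange_le p lam) _
  simpa [adjointTuple, map_smulₛₗ, ContinuousLinearMap.adjoint_id] using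
    isClosed_range_adjoint_of_iSup_range_sup_eq_top _ _ htop

end ClosedRange

section HomogeneousParts

/-- The homogeneous component of degree `j` of the power series of `f`. -/
def homPart (f : H2 d) (j : ℕ) : MvPolynomial (Fin d) ℂ :=
  ∑ α ∈ Finset.univ.finsuppAntidiag j, MvPolynomial.monomial α (coeff f α)

theorem homPart_isHomogeneous (f : H2 d) (j : ℕ) : (homPart f j).IsHomogeneous j := by
  refine MvPolynomial.IsHomogeneous.sum _ _ _ fun α hα =>
    MvPolynomial.isHomogeneous_monomial _ ?_
  rw [Finsupp.degree_eq_sum]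
  exact (Finset.mem_finsuppAntidiag.1 hα).1

theorem hasSum_inner_homPart (k f : H2 d) :
    HasSum (fun j => inner ℂ k (ofPoly (homPart f j))) (inner ℂ k f) := by
  have h := (innerSL ℂ k).hasSum (hasSum_ofPoly_monomial f)
  refine (h.tsum_fiberwise fun α => ∑ i, α i).congr_fun fun j => ?_
  have fiber_eq : (fun α : Fin d →₀ ℕ => ∑ i, α i) ⁻¹' {j} =
      ((Finset.univ.finsuppAntidiag j : Finset (Fin d →₀ ℕ)) : Set (Fin d →₀ ℕ)) := by
    ext α
    simp [Finset.mem_finsuppAntidiag]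
  rw [fiber_eq, homPart, map_sum, inner_sum]
  exact (Finset.tsum_subtype' (Finset.univ.finsuppAntidiag j) fun α =>
    inner ℂ k (ofPoly (MvPolynomial.monomial α (coeff f α)))).symm

end HomogeneousParts

section Neighbourhoods

theorem continuous_eval_point_one (p : MvPolynomial (Fin (m + 1)) ℂ) :
    Continuous fun lam => MvPolynomial.eval (point lam 1) p := by
  refine (MvPolynomial.continuous_eval p).comp (continuous_pi fun i => ?_)
  refine Fin.lastCases ?_ (fun i => ?_) i <;>
    simp only [point, Fin.snoc_last, Fin.snoc_castSucc] <;> fun_prop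

theorem conjVec_conjVec (lam : EuclideanSpace ℂ (Fin m)) : conjVec (conjVec lam) = lam := by
  ext i
  simp [conjVec]

theorem norm_conjVec (lam : EuclideanSpace ℂ (Fin m)) : ‖conjVec lam‖ = ‖lam‖ := by
  simp [EuclideanSpace.norm_eq, conjVec]

variable {p : MvPolynomial (Fin (m + 1)) ℂ} (hp : p.IsHomogeneous n)
  (hpd : MvPolynomial.eval (Pi.single (Fin.last m) 1) p ≠ 0)

include hp hpd

theorem exists_mul_norm_le_of_mem_roots_slice :
    ∃ δ : ℝ, 0 < δ ∧ ∀ lam, ∀ μ ∈ (slice p lam).roots, δ * ‖μ‖ ≤ ‖lam‖ := by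
  have eval_ne_zero : ∀ᶠ lam in 𝓝 0, MvPolynomial.eval (point lam 1) p ≠ 0 :=
    (continuous_eval_point_one p).continuousAt.eventually_ne (by rwa [point_zero_one])
  obtain ⟨δ, hδ, hball⟩ := Metric.eventually_nhds_iff_ball.1 eval_ne_zero
  refine ⟨δ, hδ, fun lam μ hμ => ?_⟩
  rcases eq_or_ne μ 0 with rfl | hμ0
  · simp
  by_contra! hlt
  refine hball (μ⁻¹ • lam) ?_ ?_
  · rw [mem_ball_zero_iff, norm_smul, norm_inv, inv_mul_lt_iff₀ (norm_pos_iff.2 hμ0), mul_comm]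
    exact hlt
  · have hroot := (Polynomial.mem_roots (slice_ne_zero hp hpd lam)).1 hμ
    rw [Polynomial.IsRoot, eval_slice] at hroot
    rw [← inv_mul_cancel₀ hμ0, eval_point_smul hp, hroot, mul_zero]

theorem eventually_roots_slice_in_ball :
    ∀ᶠ lam in 𝓝 0, ∀ μ ∈ (slice p lam).roots, ‖point lam μ‖ < 1 := by
  obtain ⟨δ, hδ, hroots⟩ := exists_mul_norm_le_of_mem_roots_slice hp hpd
  have hsmall : ∀ᶠ lam : EuclideanSpace ℂ (Fin m) in 𝓝 0, ‖lam‖ ^ 2 + (‖lam‖ / δ) ^ 2 < 1 :=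
    (Continuous.tendsto (by fun_prop) _).eventually_lt_const (by simp)
  filter_upwards [hsmall] with lam hlam μ hμ
  refine norm_point_lt_one_iff.2 (lt_of_le_of_lt ?_ hlam)
  gcongr
  exact (le_div_iff₀' hδ).2 (hroots lam μ hμ)

open Classical in
theorem countP_roots_slice_eq_iff {lam : EuclideanSpace ℂ (Fin m)} :
    (slice p lam).roots.countP (fun μ => point lam μ ∈ Metric.ball 0 1) = n ↔
      ∀ μ ∈ (slice p lam).roots, ‖point lam μ‖ < 1 := by
  rw [← natDegree_slice hp hpd lam, (IsAlgClosed.splits (slice p lam)).natDegree_eq_card_roots,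
    Multiset.countP_eq_card]
  simp only [mem_ball_zero_iff]

theorem IsBundleNhd.norm_point_lt_one {U : Set (EuclideanSpace ℂ (Fin m))}
    (hU : IsBundleNhd n p U) {lam : EuclideanSpace ℂ (Fin m)} (hlam : lam ∈ U) :
    ∀ μ ∈ (slice p lam).roots, ‖point lam μ‖ < 1 :=
  (countP_roots_slice_eq_iff hp hpd).1 (hU.roots_in_ball lam hlam)

theorem exists_isBundleNhd_ball : ∃ r : ℝ, 0 < r ∧
    IsBundleNhd n p (Metric.ball (0 : EuclideanSpace ℂ (Fin m)) r) := by
  obtain ⟨r, hr, hball⟩ := Metric.eventually_nhds_iff_ball.1 <|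
    (eventually_roots_slice_in_ball hp hpd).and (Metric.ball_mem_nhds 0 one_pos)
  refine ⟨r, hr, Metric.isOpen_ball, Metric.isConnected_ball hr, Metric.mem_ball_self hr,
    fun lam hlam => (hball lam hlam).2, fun lam hlam => ?_,
    fun lam hlam => (countP_roots_slice_eq_iff hp hpd).2 (hball lam hlam).1⟩
  rwa [mem_ball_zero_iff, norm_conjVec, ← mem_ball_zero_iff]

end Neighbourhoods

section CowenDouglas

variable {p : MvPolynomial (Fin (m + 1)) ℂ} (hp : p.IsHomogeneous n)
  (hpd : MvPolynomial.eval (Pi.single (Fin.last m) 1) p ≠ 0)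

include hp hpd

/-- Along the ray `s • (lam, μ)` the orthogonality relations form a power series in `s` whose
coefficients are the derivatives of the homogeneous parts at `(lam, μ)`. -/
theorem dvd_homPart {f : H2 (m + 1)}
    (hf : ∀ᶠ lam in 𝓝 0, ∀ k ∈ derivKernels p lam, inner ℂ k f = 0) (j : ℕ) :
    p ∣ homPart f j := by
  refine dvd_of_eventually_slice_dvd hp hpd (lam₀ := 0) (.of_forall fun lam => ?_)
  refine (dvd_iff_eval_iterate_derivative_eq_zero (slice_ne_zero hp hpd lam)).2 fun μ l hl => ?_
  refine congrFun (eq_zero_of_eventually_hasSum_pow_smul (𝕜 := ℂ) (a := fun i =>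
    (Polynomial.derivative^[l] (slice (homPart f i) lam)).eval μ) ?_) j
  have tendsto_smul : Filter.Tendsto (fun s : ℂ => s • lam) (𝓝[≠] 0) (𝓝 0) :=
    ((continuous_id.smul continuous_const).tendsto' 0 0 (zero_smul ℂ lam)).mono_left
      nhdsWithin_le_nhds
  filter_upwards [tendsto_smul.eventually ((eventually_roots_slice_in_ball hp hpd).and hf),
    self_mem_nhdsWithin] with s ⟨hball, horth⟩ hs
  have hl' := lt_rootMultiplicity_slice_smul hp hpd hl hs
  have hroot : s * μ ∈ (slice p (s • lam)).roots :=
    Multiset.count_pos.1 (by rw [Polynomial.count_roots]; exact l.zero_le.trans_lt hl')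
  obtain ⟨k, hk⟩ := exists_isDerivKernel (hball _ hroot) l
  have hsum := (hasSum_inner_homPart k f).mul_left (s ^ l)
  rw [horth k ⟨_, l, hl', hk⟩, mul_zero] at hsum
  refine hsum.congr_fun fun i => ?_
  rw [hk.inner_ofPoly, iterate_derivative_slice_smul (homPart_isHomogeneous f i), smul_eq_mul]

theorem eq_zero_of_orthogonal_derivKernels {f : H2 (m + 1)} (hfp : f ∈ Hp p)
    (hf : ∀ᶠ lam in 𝓝 0, ∀ k ∈ derivKernels p lam, inner ℂ k f = 0) : f = 0 := by
  have inner_homPart (j : ℕ) : inner ℂ f (ofPoly (homPart f j)) = 0 := by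
    obtain ⟨g, hg⟩ := dvd_homPart hp hpd hf j
    rw [hg, ← polyOp_ofPoly]
    exact (Submodule.mem_orthogonal' _ _).1 hfp _ (polyMul_eq_range p ▸ ⟨_, rfl⟩)
  have hsum := hasSum_inner_homPart f f
  simp only [inner_homPart] at hsum
  exact inner_self_eq_zero.1 (hsum.unique hasSum_zero)

variable {U : Set (EuclideanSpace ℂ (Fin m))} (hU : IsBundleNhd n p U)

include hU

theorem map_jointKer_eq_span {lam : EuclideanSpace ℂ (Fin m)} (hlam : lam ∈ U) :
    (jointKer (adjointTuple p) (conjVec lam)).map (Hp p).subtype =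
      Submodule.span ℂ (derivKernels p lam) :=
  (map_jointKer_eq p lam).trans (orthogonal_sliceRange_eq_span (slice_ne_zero hp hpd lam)
    (hU.norm_point_lt_one hp hpd hlam)).2.2

theorem dense_span_jointKer :
    (⨆ ω ∈ U, jointKer (adjointTuple p) ω).topologicalClosure = ⊤ := by
  rw [Submodule.topologicalClosure_eq_top_iff, Submodule.eq_bot_iff]
  intro h hh
  refine Subtype.ext (eq_zero_of_orthogonal_derivKernels hp hpd h.2 ?_)
  filter_upwards [hU.isOpen.mem_nhds hU.zero_mem] with lam hlam k hk
  replace hk := Submodule.subset_span (R := ℂ) hk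
  rw [← map_jointKer_eq_span hp hpd hU hlam] at hk
  obtain ⟨x, hx, rfl⟩ := hk
  exact (Submodule.mem_orthogonal _ _).1 hh x
    (Submodule.mem_iSup_of_mem _ (Submodule.mem_iSup_of_mem (hU.conj_mem lam hlam) hx))

theorem finiteDimensional_and_finrank_jointKer {lam : EuclideanSpace ℂ (Fin m)}
    (hlam : lam ∈ U) :
    FiniteDimensional ℂ (jointKer (adjointTuple p) (conjVec lam)) ∧
      Module.finrank ℂ (jointKer (adjointTuple p) (conjVec lam)) = n := by
  let e := Submodule.equivMapOfInjective _ (Hp p).subtype_injective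
    (jointKer (adjointTuple p) (conjVec lam))
  obtain ⟨finite, finrank_eq, -⟩ := orthogonal_sliceRange_eq_span (slice_ne_zero hp hpd lam)
    (hU.norm_point_lt_one hp hpd hlam)
  rw [← map_jointKer_eq] at finite finrank_eq
  exact ⟨e.symm.finiteDimensional, by rw [e.finrank_eq, finrank_eq, natDegree_slice hp hpd]⟩

theorem isCowenDouglas_adjointTuple : IsCowenDouglas n U (adjointTuple p) := by
  have forall_of_conj {P : EuclideanSpace ℂ (Fin m) → Prop}
      (H : ∀ lam ∈ U, P (conjVec lam)) : ∀ ω ∈ U, P ω := fun ω hω =>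
    conjVec_conjVec ω ▸ H _ (hU.conj_mem ω hω)
  exact
    { isOpen := hU.isOpen
      isConnected := hU.isConnected
      commute := commute_adjointTuple p
      isClosed_range := forall_of_conj fun lam hlam =>
        isClosed_range_adjointTuple (slice_ne_zero hp hpd lam) (hU.norm_point_lt_one hp hpd hlam)
      finiteDimensional := forall_of_conj fun lam hlam =>
        (finiteDimensional_and_finrank_jointKer hp hpd hU hlam).1
      finrank_eq := forall_of_conj fun lam hlam =>
        (finiteDimensional_and_finrank_jointKer hp hpd hU hlam).2
      dense_span := dense_span_jointKer hp hpd hU }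

end CowenDouglas

end DruryArveson

end

/-- Here `d = m + 1`. -/
theorem theorem5p5 (m n : ℕ) (p : MvPolynomial (Fin (m + 1)) ℂ) (hp : p.IsHomogeneous n)
    (hpd : MvPolynomial.eval (Pi.single (Fin.last m) 1) p ≠ 0) :
    (∃ r : ℝ, 0 < r ∧
      DruryArveson.IsBundleNhd n p (Metric.ball (0 : EuclideanSpace ℂ (Fin m)) r)) ∧
    ∀ U : Set (EuclideanSpace ℂ (Fin m)), DruryArveson.IsBundleNhd n p U →
      IsCowenDouglas n U (DruryArveson.adjointTuple p) ∧
      ∀ lam ∈ U,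
        (jointKer (DruryArveson.adjointTuple p) (DruryArveson.conjVec lam)).map
            (DruryArveson.Hp p).subtype =
          Submodule.span ℂ {k : DruryArveson.H2 (m + 1) | ∃ (μ : ℂ) (l : ℕ),
            l < (DruryArveson.slice p lam).rootMultiplicity μ ∧
              DruryArveson.IsDerivKernel lam μ l k} :=
  ⟨DruryArveson.exists_isBundleNhd_ball hp hpd, fun _ hU =>
    ⟨DruryArveson.isCowenDouglas_adjointTuple hp hpd hU, fun _ hlam =>
      DruryArveson.map_jointKer_eq_span hp hpd hU hlam⟩⟩
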